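/- Let $M$ be a non-empty smooth manifold (Hausdorff, second countable) without boundary, of dimension at least $1$, let $\mu$ be a volume form on $M$ (a smooth nowhere vanishing form of top degree), let $M$ be oriented by $\mu$, and let $m_\mu$ be the Borel measure of $\mu$, i.e. $\int_M f\,\mathrm{d}m_\mu=\int_M f\mu$ for continuous compactly supported $f$. Let $b$ be a geometric structure on $M$, i.e. a smooth non-degenerate $(0,2)$-tensor field, and suppose that $b$ is not skew-symmetric. For $F\in C^\infty(M,\mathbb{R})$ let $\nabla^L_bF$ and $\nabla^R_bF$ be the vector fields with $$b(\nabla^L_bF,X)=\mathrm{d}F\cdot X=b(X,\nabla^R_bF)\quad\text{for all vector fields }X,$$ let $\{F,G\}_b=b(\nabla^L_bF,\nabla^L_bG)$, and let $\Delta^L_bF=\operatorname{div}_\mu(\nabla^L_bF)$, $\Delta^R_bF=\operatorname{div}_\mu(\nabla^R_bF)$, where $\operatorname{div}_\mu X$ is defined by $\mathrm{d}(\mathbf{i}_X\mu)=(\operatorname{div}_\mu X)\,\mu$. For a Borel set $K\subseteq M$ consider the Dirichlet energy $$\mathcal{E}_K(F)=\frac12\int_K\{F,F\}_b\,\mathrm{d}m_\mu,\qquad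 \mathcal{E}(F)=\mathcal{E}_M(F).$$ Then the Euler–Lagrange equation of the Dirichlet energy, under compactly supported variations, is $\frac12(\Delta^L_bF+\Delta^R_bF)=0$. That is, for every $F\in C^\infty(M,\mathbb{R})$: 1. if $\{F,F\}_b$ is $m_\mu$-integrable, then $\frac12(\Delta^L_bF+\Delta^R_bF)=0$ on $M$ if and only if for every $\delta F\in C^\infty_c(M,\mathbb{R})$ the derivative $\frac{\mathrm{d}}{\mathrm{d}\lambda}\mathcal{E}(F+\lambda\,\delta F)\big|_{\lambda=0}$ exists and equals $0$; 2. with no integrability assumption, $\frac12(\Delta^L_bF+\Delta^R_bF)=0$ on $M$ if and only if for every compact $K\subseteq M$ and every $\delta F\in C^\infty(M,\mathbb{R})$ with support in $K$ the derivative $\frac{\mathrm{d}}{\mathrm{d}\lambda}\mathcal{E}_K(F+\lambda\,\delta F)\big|_{\lambda=0}$ exists and equals $0$. -/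

import Mathlib

open Set MeasureTheory Manifold
open scoped ContDiff Bundle

namespace GeomDirichlet

noncomputable section

/-! Throughout, `M` is a manifold without boundary, of dimension `n` or `n + 1`, modelled on
Euclidean space with its smooth structure; `chartAt (EuclideanSpace ℝ (Fin n)) x` is the preferred
chart at `x`. -/

/-- A geometric structure: a smooth non-degenerate `(0,2)`-tensor field (a smooth section of the
bundle of bilinear forms on the tangent spaces, non-degenerate in each entry at every point). No
symmetry is required. -/
structure GeometricStructure (n : ℕ) (M : Type*) [TopologicalSpace M]
    [ChartedSpace (EuclideanSpace ℝ (Fin n)) M] [IsManifold (𝓡 n) ∞ M] where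
  toFun : ∀ x : M, TangentSpace (𝓡 n) x →L[ℝ] TangentSpace (𝓡 n) x →L[ℝ] ℝ
  smooth : ContMDiff (𝓡 n)
    ((𝓡 n).prod 𝓘(ℝ, EuclideanSpace ℝ (Fin n) →L[ℝ] EuclideanSpace ℝ (Fin n) →L[ℝ] ℝ)) ∞
    (fun x ↦ Bundle.TotalSpace.mk'
      (E := fun x : M ↦ TangentSpace (𝓡 n) x →L[ℝ] TangentSpace (𝓡 n) x →L[ℝ] ℝ)
      (EuclideanSpace ℝ (Fin n) →L[ℝ] EuclideanSpace ℝ (Fin n) →L[ℝ] ℝ) x (toFun x))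
  nondegenerate_left : ∀ (x : M) (v : TangentSpace (𝓡 n) x), (∀ w, toFun x v w = 0) → v = 0
  nondegenerate_right : ∀ (x : M) (w : TangentSpace (𝓡 n) x), (∀ v, toFun x v w = 0) → w = 0

/-- `b` is skew-symmetric. -/
def GeometricStructure.IsSkew {n : ℕ} {M : Type*} [TopologicalSpace M]
    [ChartedSpace (EuclideanSpace ℝ (Fin n)) M] [IsManifold (𝓡 n) ∞ M]
    (b : GeometricStructure n M) : Prop :=
  ∀ (x : M) (v w : TangentSpace (𝓡 n) x), b.toFun x v w = -b.toFun x w v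

/-- The differential `dF_x : T_xM → ℝ` of a function `F : M → ℝ`. -/
def differential {n : ℕ} {M : Type*} [TopologicalSpace M]
    [ChartedSpace (EuclideanSpace ℝ (Fin n)) M] (F : M → ℝ) (x : M) :
    TangentSpace (𝓡 n) x →L[ℝ] ℝ :=
  mfderiv (𝓡 n) 𝓘(ℝ, ℝ) F x

/-- A bilinear form with trivial left kernel on a finite-dimensional space represents every linear
functional. -/
theorem existsUnique_riesz {V : Type*} [AddCommGroup V] [Module ℝ V] [FiniteDimensional ℝ V]
    (B : V →ₗ[ℝ] V →ₗ[ℝ] ℝ) (hB : ∀ v, (∀ w, B v w = 0) → v = 0) (φ : V →ₗ[ℝ] ℝ) :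
    ∃! v, ∀ w, B v w = φ w := by
  have hinj : Function.Injective B := by
    rw [injective_iff_map_eq_zero]
    intro v hv
    exact hB v fun w ↦ by rw [hv]; rfl
  have hsurj : Function.Surjective B :=
    (LinearMap.injective_iff_surjective_of_finrank_eq_finrank
      (Subspace.dual_finrank_eq (K := ℝ) (V := V)).symm).1 hinj
  obtain ⟨v, hv⟩ := hsurj φ
  refine ⟨v, fun w ↦ by rw [hv], fun v' hv' ↦ hinj ?_⟩
  rw [hv]
  exact LinearMap.ext hv'

theorem GeometricStructure.existsUnique_left {n : ℕ} {M : Type*} [TopologicalSpace M]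
    [ChartedSpace (EuclideanSpace ℝ (Fin n)) M] [IsManifold (𝓡 n) ∞ M]
    (b : GeometricStructure n M) (F : M → ℝ) (x : M) :
    ∃! v : TangentSpace (𝓡 n) x, ∀ w, b.toFun x v w = differential F x w :=
  haveI : FiniteDimensional ℝ (TangentSpace (𝓡 n) x) :=
    inferInstanceAs (FiniteDimensional ℝ (EuclideanSpace ℝ (Fin n)))
  existsUnique_riesz (V := TangentSpace (𝓡 n) x)
    (LinearMap.mk₂ ℝ (fun v w ↦ b.toFun x v w) (by simp) (by simp) (by simp) (by simp))
    (b.nondegenerate_left x) (differential F x).toLinearMap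

theorem GeometricStructure.existsUnique_right {n : ℕ} {M : Type*} [TopologicalSpace M]
    [ChartedSpace (EuclideanSpace ℝ (Fin n)) M] [IsManifold (𝓡 n) ∞ M]
    (b : GeometricStructure n M) (F : M → ℝ) (x : M) :
    ∃! v : TangentSpace (𝓡 n) x, ∀ w, b.toFun x w v = differential F x w :=
  haveI : FiniteDimensional ℝ (TangentSpace (𝓡 n) x) :=
    inferInstanceAs (FiniteDimensional ℝ (EuclideanSpace ℝ (Fin n)))
  existsUnique_riesz (V := TangentSpace (𝓡 n) x)
    (LinearMap.mk₂ ℝ (fun v w ↦ b.toFun x w v) (by simp) (by simp) (by simp) (by simp))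
    (b.nondegenerate_right x) (differential F x).toLinearMap

/-- The left-gradient: the vector field with `b(∇ᴸF, X) = dF · X` for all `X`. -/
def GeometricStructure.leftGrad {n : ℕ} {M : Type*} [TopologicalSpace M]
    [ChartedSpace (EuclideanSpace ℝ (Fin n)) M] [IsManifold (𝓡 n) ∞ M]
    (b : GeometricStructure n M) (F : M → ℝ) (x : M) : TangentSpace (𝓡 n) x :=
  (b.existsUnique_left F x).choose

/-- The right-gradient: the vector field with `b(X, ∇ᴿF) = dF · X` for all `X`. -/
def GeometricStructure.rightGrad {n : ℕ} {M : Type*} [TopologicalSpace M]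
    [ChartedSpace (EuclideanSpace ℝ (Fin n)) M] [IsManifold (𝓡 n) ∞ M]
    (b : GeometricStructure n M) (F : M → ℝ) (x : M) : TangentSpace (𝓡 n) x :=
  (b.existsUnique_right F x).choose

/-- The bracket `{F, G}_b = b(∇ᴸF, ∇ᴸG)`. -/
def GeometricStructure.bracket {n : ℕ} {M : Type*} [TopologicalSpace M]
    [ChartedSpace (EuclideanSpace ℝ (Fin n)) M] [IsManifold (𝓡 n) ∞ M]
    (b : GeometricStructure n M) (F G : M → ℝ) (x : M) : ℝ :=
  b.toFun x (b.leftGrad F x) (b.leftGrad G x)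

/-- The `k`-form `η` on `M` read in the chart `e` at `x₀`: the pull-back of `η` by `e⁻¹`
(meaningful on the target of `e`). -/
def formInChart {n k : ℕ} {M : Type*} [TopologicalSpace M]
    [ChartedSpace (EuclideanSpace ℝ (Fin n)) M]
    (η : ∀ x : M, TangentSpace (𝓡 n) x [⋀^Fin k]→L[ℝ] ℝ) (x₀ : M)
    (y : EuclideanSpace ℝ (Fin n)) : EuclideanSpace ℝ (Fin n) [⋀^Fin k]→L[ℝ] ℝ :=
  (η ((chartAt (EuclideanSpace ℝ (Fin n)) x₀).symm y)).compContinuousLinearMap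
    (mfderiv (𝓡 n) (𝓡 n) (chartAt (EuclideanSpace ℝ (Fin n)) x₀).symm y)

/-- The vector field `X` on `M` read in the chart `e` at `x₀`: the push-forward of `X` by `e`
(meaningful on the target of `e`). -/
def fieldInChart {n : ℕ} {M : Type*} [TopologicalSpace M]
    [ChartedSpace (EuclideanSpace ℝ (Fin n)) M]
    (X : ∀ x : M, TangentSpace (𝓡 n) x) (x₀ : M)
    (y : EuclideanSpace ℝ (Fin n)) : EuclideanSpace ℝ (Fin n) :=
  mfderiv (𝓡 n) (𝓡 n) (chartAt (EuclideanSpace ℝ (Fin n)) x₀)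
    ((chartAt (EuclideanSpace ℝ (Fin n)) x₀).symm y)
    (X ((chartAt (EuclideanSpace ℝ (Fin n)) x₀).symm y))

/-- A volume form on an `n`-dimensional manifold: a smooth nowhere vanishing `n`-form. The manifold
carries the orientation for which this form is positive. -/
structure VolumeForm (n : ℕ) (M : Type*) [TopologicalSpace M]
    [ChartedSpace (EuclideanSpace ℝ (Fin n)) M] [IsManifold (𝓡 n) ∞ M] where
  toFun : ∀ x : M, TangentSpace (𝓡 n) x [⋀^Fin n]→L[ℝ] ℝ
  smooth : ∀ x₀ : M, ContDiffOn ℝ ∞ (formInChart toFun x₀)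
    (chartAt (EuclideanSpace ℝ (Fin n)) x₀).target
  ne_zero : ∀ x : M, toFun x ≠ 0

theorem VolumeForm.inChart_ne_zero {n : ℕ} {M : Type*} [TopologicalSpace M]
    [ChartedSpace (EuclideanSpace ℝ (Fin n)) M] [IsManifold (𝓡 n) ∞ M]
    (μ : VolumeForm n M) (x : M) :
    formInChart μ.toFun x (chartAt (EuclideanSpace ℝ (Fin n)) x x) ≠ 0 := by
  intro h
  have he := (mdifferentiable_chart (I := 𝓡 n) x).symm
  have hy := mem_chart_target (EuclideanSpace ℝ (Fin n)) x
  have hs := he.mfderiv_surjective hy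
  apply μ.ne_zero ((chartAt (EuclideanSpace ℝ (Fin n)) x).symm
    (chartAt (EuclideanSpace ℝ (Fin n)) x x))
  ext v
  choose u hu using fun i ↦ hs (v i)
  have := DFunLike.congr_fun h u
  rw [← funext hu]
  exact this

/-- Forms of top degree are multiples of a given non-zero one. -/
theorem existsUnique_topForm {n : ℕ} (α β : EuclideanSpace ℝ (Fin n) [⋀^Fin n]→L[ℝ] ℝ)
    (hβ : β ≠ 0) : ∃! c : ℝ, α = c • β := by
  set B := (EuclideanSpace.basisFun (Fin n) ℝ).toBasis
  have hα' := α.toAlternatingMap.eq_smul_basis_det B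
  have hβ' := β.toAlternatingMap.eq_smul_basis_det B
  have h0 : β.toAlternatingMap B ≠ 0 := by
    intro h
    apply hβ
    apply ContinuousAlternatingMap.toAlternatingMap_injective
    rw [hβ', h, zero_smul]; rfl
  refine ⟨α.toAlternatingMap B / β.toAlternatingMap B, ?_, ?_⟩
  · apply ContinuousAlternatingMap.toAlternatingMap_injective
    ext v
    have h1 := DFunLike.congr_fun hα' v
    have h2 := DFunLike.congr_fun hβ' v
    simp only [AlternatingMap.smul_apply, smul_eq_mul] at h1 h2
    change α.toAlternatingMap v = _ * β.toAlternatingMap v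
    rw [h1, h2]
    field_simp
  · rintro c rfl
    change c = c * β.toAlternatingMap B / β.toAlternatingMap B
    field_simp

/-- The divergence `div_μ X`, defined by `d(i_X μ) = (div_μ X) μ`. At `x` the identity is read in
the chart at `x`, where `i_X μ` is the contraction of the form with the field. -/
def divergence {n : ℕ} {M : Type*} [TopologicalSpace M]
    [ChartedSpace (EuclideanSpace ℝ (Fin (n + 1))) M] [IsManifold (𝓡 (n + 1)) ∞ M]
    (μ : VolumeForm (n + 1) M) (X : ∀ x : M, TangentSpace (𝓡 (n + 1)) x) (x : M) : ℝ :=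
  (existsUnique_topForm
    (extDeriv (fun y ↦ (formInChart μ.toFun x y).curryLeft (fieldInChart X x y))
      (chartAt (EuclideanSpace ℝ (Fin (n + 1))) x x))
    (formInChart μ.toFun x (chartAt (EuclideanSpace ℝ (Fin (n + 1))) x x))
    (μ.inChart_ne_zero x)).choose

/-- The left-Laplacian `div_μ (∇ᴸF)`. -/
def leftLaplacian {n : ℕ} {M : Type*} [TopologicalSpace M]
    [ChartedSpace (EuclideanSpace ℝ (Fin (n + 1))) M] [IsManifold (𝓡 (n + 1)) ∞ M]
    (b : GeometricStructure (n + 1) M) (μ : VolumeForm (n + 1) M) (F : M → ℝ) : M → ℝ :=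
  divergence μ (b.leftGrad F)

/-- The right-Laplacian `div_μ (∇ᴿF)`. -/
def rightLaplacian {n : ℕ} {M : Type*} [TopologicalSpace M]
    [ChartedSpace (EuclideanSpace ℝ (Fin (n + 1))) M] [IsManifold (𝓡 (n + 1)) ∞ M]
    (b : GeometricStructure (n + 1) M) (μ : VolumeForm (n + 1) M) (F : M → ℝ) : M → ℝ :=
  divergence μ (b.rightGrad F)

/-- The part of the measure of `μ` that lives on the domain of the chart `e` at `x₀`: there, it has
density `|μ(∂₁, …, ∂ₙ)|` with respect to Lebesgue measure in the coordinates. (In a positively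
oriented chart the absolute value can be dropped; in a negatively oriented one it accounts for the
sign in the definition of the integral of a form.) -/
def chartMeasure {n : ℕ} {M : Type*} [TopologicalSpace M]
    [ChartedSpace (EuclideanSpace ℝ (Fin n)) M] [IsManifold (𝓡 n) ∞ M] [MeasurableSpace M]
    (μ : VolumeForm n M) (x₀ : M) : Measure M :=
  ((volume.restrict (chartAt (EuclideanSpace ℝ (Fin n)) x₀).target).withDensity
    (fun y ↦ ENNReal.ofReal |formInChart μ.toFun x₀ y (EuclideanSpace.basisFun (Fin n) ℝ)|)).map
    (chartAt (EuclideanSpace ℝ (Fin n)) x₀).symm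

theorem exists_countable_charts (n : ℕ) (M : Type*) [TopologicalSpace M] [Nonempty M]
    [SecondCountableTopology M] [ChartedSpace (EuclideanSpace ℝ (Fin n)) M] :
    ∃ c : ℕ → M, ⋃ k, (chartAt (EuclideanSpace ℝ (Fin n)) (c k)).source = univ := by
  obtain ⟨s, hs, hcov⟩ := TopologicalSpace.countable_cover_nhds
    (fun x : M ↦ chart_source_mem_nhds (EuclideanSpace ℝ (Fin n)) x)
  have hne : s.Nonempty := by
    obtain ⟨x⟩ := ‹Nonempty M›
    have hx : x ∈ ⋃ x ∈ s, (chartAt (EuclideanSpace ℝ (Fin n)) x).source := hcov ▸ mem_univ x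
    simp only [mem_iUnion] at hx
    obtain ⟨y, hy, -⟩ := hx
    exact ⟨y, hy⟩
  obtain ⟨c, rfl⟩ := hs.exists_eq_range hne
  exact ⟨c, by simpa using hcov⟩

/-- The measure `m_μ` of the volume form: the domains of countably many charts covering `M` are cut
into disjoint Borel pieces, and on each piece the measure is the one computed in the chart. -/
def volumeMeasure {n : ℕ} {M : Type*} [TopologicalSpace M] [Nonempty M]
    [SecondCountableTopology M] [ChartedSpace (EuclideanSpace ℝ (Fin n)) M]
    [IsManifold (𝓡 n) ∞ M] [MeasurableSpace M] (μ : VolumeForm n M) : Measure M :=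
  Measure.sum fun k : ℕ ↦
    (chartMeasure μ ((exists_countable_charts n M).choose k)).restrict
      (disjointed (fun j ↦ (chartAt (EuclideanSpace ℝ (Fin n))
        ((exists_countable_charts n M).choose j)).source) k)

/-- The Dirichlet energy over a set `K`, that is `½ ∫_K {F, F}_b dm_μ`. -/
def dirichletEnergyOn {n : ℕ} {M : Type*} [TopologicalSpace M] [Nonempty M]
    [SecondCountableTopology M] [ChartedSpace (EuclideanSpace ℝ (Fin n)) M]
    [IsManifold (𝓡 n) ∞ M] [MeasurableSpace M]
    (b : GeometricStructure n M) (μ : VolumeForm n M) (K : Set M) (F : M → ℝ) : ℝ :=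
  (1 / 2) * ∫ x in K, b.bracket F F x ∂(volumeMeasure μ)

/-- The Dirichlet energy `½ ∫_M {F, F}_b dm_μ`. -/
def dirichletEnergy {n : ℕ} {M : Type*} [TopologicalSpace M] [Nonempty M]
    [SecondCountableTopology M] [ChartedSpace (EuclideanSpace ℝ (Fin n)) M]
    [IsManifold (𝓡 n) ∞ M] [MeasurableSpace M]
    (b : GeometricStructure n M) (μ : VolumeForm n M) (F : M → ℝ) : ℝ :=
  (1 / 2) * ∫ x, b.bracket F F x ∂(volumeMeasure μ)

/-- The energy of `F` is finite, in the sense that its integral converges absolutely. -/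
def HasFiniteEnergy {n : ℕ} {M : Type*} [TopologicalSpace M] [Nonempty M]
    [SecondCountableTopology M] [ChartedSpace (EuclideanSpace ℝ (Fin n)) M]
    [IsManifold (𝓡 n) ∞ M] [MeasurableSpace M]
    (b : GeometricStructure n M) (μ : VolumeForm n M) (F : M → ℝ) : Prop :=
  Integrable (b.bracket F F) (volumeMeasure μ)

/-- `F` is a critical point of the Dirichlet energy: the derivative of `t ↦ 𝓔(F + t δF)` at `0`
exists and vanishes for every smooth compactly supported variation `δF`. -/
def IsCritical {n : ℕ} {M : Type*} [TopologicalSpace M] [Nonempty M]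
    [SecondCountableTopology M] [ChartedSpace (EuclideanSpace ℝ (Fin n)) M]
    [IsManifold (𝓡 n) ∞ M] [MeasurableSpace M]
    (b : GeometricStructure n M) (μ : VolumeForm n M) (F : M → ℝ) : Prop :=
  ∀ δF : M → ℝ, ContMDiff (𝓡 n) 𝓘(ℝ, ℝ) ∞ δF → HasCompactSupport δF →
    HasDerivAt (fun t : ℝ ↦ dirichletEnergy b μ (fun x ↦ F x + t * δF x)) 0 0

/-- `F` is a critical point of the Dirichlet energy on compact sets: the derivative of
`t ↦ 𝓔_K(F + t δF)` at `0` exists and vanishes for every smooth variation `δF` supported in the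
compact set `K`. This makes sense for every smooth `F`, of finite energy or not. -/
def IsLocallyCritical {n : ℕ} {M : Type*} [TopologicalSpace M] [Nonempty M]
    [SecondCountableTopology M] [ChartedSpace (EuclideanSpace ℝ (Fin n)) M]
    [IsManifold (𝓡 n) ∞ M] [MeasurableSpace M]
    (b : GeometricStructure n M) (μ : VolumeForm n M) (F : M → ℝ) : Prop :=
  ∀ (K : Set M) (δF : M → ℝ), IsCompact K → ContMDiff (𝓡 n) 𝓘(ℝ, ℝ) ∞ δF → tsupport δF ⊆ K →
    HasDerivAt (fun t : ℝ ↦ dirichletEnergyOn b μ K (fun x ↦ F x + t * δF x)) 0 0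

end

end GeomDirichlet

/-! The energy is exactly quadratic along a line: `{F + tG, F + tG} = {F, F} + t({F, G} + {G, F}) +
t²{G, G}`. Unwinding the two gradients gives `{G, F} = dG(∇ᴸF)` and `{F, G} = dG(∇ᴿF)`, so the
linear coefficient is `dG` applied to `∇ᴸF + ∇ᴿF` (`bracket_add_const_mul`). For compactly supported
`G`, the divergence theorem `integral_differential_eq_neg` turns half its integral into `-∫ G ·
½(ΔᴸF + ΔᴿF)`. This is the first variation, `hasDerivAt_dirichletEnergyOn`. Since `½(ΔᴸF + ΔᴿF)` is
continuous, it vanishes identically exactly when it is orthogonal to all test functions.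

Most of the work lies in the divergence theorem. In a chart, with `ρ` the density of the volume
form, the divergence is `ρ⁻¹ ∑ ∂ᵢ(ρ Xᵢ)` (`divergence_eq_chartDivergence`), and the theorem says
that partial derivatives of compactly supported functions integrate to zero
(`setIntegral_chartDivergence`). The local form already shows that the divergence is
chart-independent: on an overlap, two candidates have the same integral against every test function
(`chartDivergence_eq`). A partition of unity then gives the global statement.

Two regularity facts are also needed. The measure agrees with the chart measure on every preferred
chart, by change of variables (`volumeMeasure_restrict_source`). The gradients are smooth, because
they solve smooth invertible linear systems (`contDiffOn_of_bilinear_eq`). -/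

namespace GeomDirichlet

noncomputable section

set_option linter.unusedSectionVars false

/-! ### Differentials, forms and transition maps in preferred charts. -/

section Charts

variable {n : ℕ} {M : Type*} [TopologicalSpace M] [ChartedSpace (EuclideanSpace ℝ (Fin n)) M]
  [IsManifold (𝓡 n) ∞ M]

local notation "𝔼" => EuclideanSpace ℝ (Fin n)

/-- The derivative of the preferred chart at `x₀`. -/
def chartDeriv (x₀ x : M) : TangentSpace (𝓡 n) x →L[ℝ] EuclideanSpace ℝ (Fin n) :=
  mfderiv (𝓡 n) (𝓡 n) (chartAt (EuclideanSpace ℝ (Fin n)) x₀) x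

/-- The derivative of the inverse of the preferred chart at `x₀`. -/
def chartSymmDeriv (x₀ : M) (y : EuclideanSpace ℝ (Fin n)) : EuclideanSpace ℝ (Fin n) →L[ℝ]
    TangentSpace (𝓡 n) ((chartAt (EuclideanSpace ℝ (Fin n)) x₀).symm y) :=
  mfderiv (𝓡 n) (𝓡 n) (chartAt (EuclideanSpace ℝ (Fin n)) x₀).symm y

theorem fieldInChart_chart {x₀ x : M} (hx : x ∈ (chartAt 𝔼 x₀).source)
    (X : ∀ x : M, TangentSpace (𝓡 n) x) :
    fieldInChart X x₀ (chartAt 𝔼 x₀ x) = chartDeriv x₀ x (X x) := by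
  simp only [fieldInChart, chartDeriv]
  rw [(chartAt 𝔼 x₀).left_inv hx]
  rfl

theorem chartDeriv_chartSymmDeriv {x₀ : M} {y : 𝔼} (hy : y ∈ (chartAt 𝔼 x₀).target) (v : 𝔼) :
    chartDeriv x₀ ((chartAt 𝔼 x₀).symm y) (chartSymmDeriv x₀ y v) = v :=
  DFunLike.congr_fun ((mdifferentiable_chart (I := 𝓡 n) x₀).comp_symm_deriv hy) v

theorem chartDeriv_injective {x₀ x : M} (hx : x ∈ (chartAt 𝔼 x₀).source) :
    Function.Injective (chartDeriv (n := n) x₀ x) :=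
  (mdifferentiable_chart (I := 𝓡 n) x₀).mfderiv_injective hx

theorem contDiffOn_comp_chart_symm {F : M → ℝ} (hF : ContMDiff (𝓡 n) 𝓘(ℝ, ℝ) ∞ F) (x₀ : M) :
    ContDiffOn ℝ ∞ (F ∘ (chartAt 𝔼 x₀).symm) (chartAt 𝔼 x₀).target := by
  rw [← contMDiffOn_iff_contDiffOn]
  exact hF.comp_contMDiffOn (contMDiffOn_chart_symm (I := 𝓡 n))

/-- The differential of a function, computed in a chart. -/
theorem differential_eq_fderiv {F : M → ℝ} {x₀ x : M} (hx : x ∈ (chartAt 𝔼 x₀).source)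
    (hF : MDifferentiableAt (𝓡 n) 𝓘(ℝ, ℝ) F x) (v : TangentSpace (𝓡 n) x) :
    differential F x v =
      fderiv ℝ (F ∘ (chartAt 𝔼 x₀).symm) (chartAt 𝔼 x₀ x) (chartDeriv x₀ x v) := by
  have he := mdifferentiable_chart (I := 𝓡 n) x₀
  have h1 : MDifferentiableAt (𝓡 n) (𝓡 n) (chartAt 𝔼 x₀).symm (chartAt 𝔼 x₀ x) :=
    he.mdifferentiableAt_symm ((chartAt 𝔼 x₀).map_source hx)
  have h2 : MDifferentiableAt (𝓡 n) 𝓘(ℝ, ℝ) F ((chartAt 𝔼 x₀).symm (chartAt 𝔼 x₀ x)) := by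
    rwa [(chartAt 𝔼 x₀).left_inv hx]
  have h3 : HasMFDerivAt (𝓡 n) 𝓘(ℝ, ℝ) (F ∘ (chartAt 𝔼 x₀).symm) (chartAt 𝔼 x₀ x) _ :=
    (h2.comp _ h1).hasMFDerivAt
  have h4 := h3.comp x (he.mdifferentiableAt hx).hasMFDerivAt
  have h5 : HasMFDerivAt (𝓡 n) 𝓘(ℝ, ℝ) F x _ := h4.congr_of_eventuallyEq (by
    filter_upwards [(chartAt 𝔼 x₀).open_source.mem_nhds hx] with z hz
    simp [(chartAt 𝔼 x₀).left_inv hz])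
  rw [differential, h5.mfderiv, mfderiv_eq_fderiv]
  rfl

/-- The transition map between two preferred charts. -/
def transition (x₀ x₁ : M) : EuclideanSpace ℝ (Fin n) → EuclideanSpace ℝ (Fin n) :=
  chartAt (EuclideanSpace ℝ (Fin n)) x₁ ∘ (chartAt (EuclideanSpace ℝ (Fin n)) x₀).symm

theorem contDiffOn_transition (x₀ x₁ : M) : ContDiffOn ℝ ∞ (transition x₀ x₁)
    ((chartAt 𝔼 x₀).symm ≫ₕ chartAt 𝔼 x₁).source := by
  rw [← contMDiffOn_iff_contDiffOn]
  refine (contMDiffOn_chart (I := 𝓡 n)).comp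
    ((contMDiffOn_chart_symm (I := 𝓡 n)).mono ?_) ?_
  · intro y hy
    exact hy.1
  · intro y hy
    exact hy.2

/-- Chain rule: near `y`, the inverse chart at `x₀` is the inverse chart at `x₁` composed with the
transition map. -/
theorem chartSymmDeriv_eq (x₀ x₁ : M) {y : 𝔼}
    (hy : y ∈ ((chartAt 𝔼 x₀).symm ≫ₕ chartAt 𝔼 x₁).source) :
    mfderiv (𝓡 n) (𝓡 n) (chartAt 𝔼 x₀).symm y =
      (mfderiv (𝓡 n) (𝓡 n) (chartAt 𝔼 x₁).symm (transition x₀ x₁ y)).comp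
        (fderiv ℝ (transition x₀ x₁) y) := by
  have hS := ((chartAt 𝔼 x₀).symm ≫ₕ chartAt 𝔼 x₁).open_source.mem_nhds hy
  have h1 : DifferentiableAt ℝ (transition x₀ x₁) y :=
    ((contDiffOn_transition x₀ x₁).contDiffAt hS).differentiableAt (by simp)
  have h2 : MDifferentiableAt (𝓡 n) (𝓡 n) (chartAt 𝔼 x₁).symm (transition x₀ x₁ y) :=
    (mdifferentiable_chart (I := 𝓡 n) x₁).mdifferentiableAt_symm ((chartAt 𝔼 x₁).map_source hy.2)
  have h3 := h2.hasMFDerivAt.comp y h1.hasFDerivAt.hasMFDerivAt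
  have h4 : HasMFDerivAt (𝓡 n) (𝓡 n) (chartAt 𝔼 x₀).symm y _ := h3.congr_of_eventuallyEq (by
    filter_upwards [hS] with z hz
    exact ((chartAt 𝔼 x₁).left_inv hz.2).symm)
  exact h4.mfderiv

theorem transition_comp_chart_symm (x₀ x₁ : M) {y : 𝔼}
    (hy : y ∈ ((chartAt 𝔼 x₀).symm ≫ₕ chartAt 𝔼 x₁).source) :
    (chartAt 𝔼 x₁).symm (transition x₀ x₁ y) = (chartAt 𝔼 x₀).symm y :=
  (chartAt 𝔼 x₁).left_inv hy.2

theorem formInChart_transition {k : ℕ} (η : ∀ x : M, TangentSpace (𝓡 n) x [⋀^Fin k]→L[ℝ] ℝ)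
    (x₀ x₁ : M) {y : 𝔼} (hy : y ∈ ((chartAt 𝔼 x₀).symm ≫ₕ chartAt 𝔼 x₁).source) :
    formInChart η x₀ y = (formInChart η x₁ (transition x₀ x₁ y)).compContinuousLinearMap
      (fderiv ℝ (transition x₀ x₁) y) := by
  ext v
  simp only [formInChart, ContinuousAlternatingMap.compContinuousLinearMap_apply]
  rw [chartSymmDeriv_eq x₀ x₁ hy]
  have h := transition_comp_chart_symm x₀ x₁ hy
  rw [h]
  rfl

end Charts

/-! ### The measure of a volume form: independence of charts, local finiteness, positivity on open
sets. -/

section Measure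

variable {n : ℕ} {M : Type*} [TopologicalSpace M] [ChartedSpace (EuclideanSpace ℝ (Fin n)) M]
  [IsManifold (𝓡 n) ∞ M]

local notation "𝔼" => EuclideanSpace ℝ (Fin n)

/-- The density of a volume form in the preferred chart at `x₀`. -/
def VolumeForm.density (μ : VolumeForm n M) (x₀ : M) (y : EuclideanSpace ℝ (Fin n)) : ℝ :=
  formInChart μ.toFun x₀ y (EuclideanSpace.basisFun (Fin n) ℝ)

theorem VolumeForm.contDiffOn_density (μ : VolumeForm n M) (x₀ : M) :
    ContDiffOn ℝ ∞ (μ.density x₀) (chartAt 𝔼 x₀).target :=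
  (ContinuousAlternatingMap.apply ℝ 𝔼 ℝ
    (EuclideanSpace.basisFun (Fin n) ℝ : Fin n → 𝔼)).contDiff.comp_contDiffOn (μ.smooth x₀)

/-- A form of top degree is determined by its value on the standard basis. -/
theorem topForm_eq_smul_det (α : 𝔼 [⋀^Fin n]→L[ℝ] ℝ) (v : Fin n → 𝔼) :
    α v = α (EuclideanSpace.basisFun (Fin n) ℝ) *
      (EuclideanSpace.basisFun (Fin n) ℝ).toBasis.det v := by
  have h := DFunLike.congr_fun
    (α.toAlternatingMap.eq_smul_basis_det (EuclideanSpace.basisFun (Fin n) ℝ).toBasis) v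
  simpa using h

theorem VolumeForm.density_ne_zero (μ : VolumeForm n M) (x₀ : M) {y : 𝔼}
    (hy : y ∈ (chartAt 𝔼 x₀).target) : μ.density x₀ y ≠ 0 := by
  intro h
  apply μ.ne_zero ((chartAt 𝔼 x₀).symm y)
  have hs := (mdifferentiable_chart (I := 𝓡 n) x₀).symm.mfderiv_surjective hy
  ext v
  choose u hu using fun i ↦ hs (v i)
  have := topForm_eq_smul_det (formInChart μ.toFun x₀ y) u
  rw [show formInChart μ.toFun x₀ y (EuclideanSpace.basisFun (Fin n) ℝ) = 0 from h, zero_mul] at this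
  rw [← funext hu]
  exact this

/-- Pulling back a top-degree form by a linear map multiplies it by the determinant. The sign is
kept here; it disappears only when absolute values are taken for the measure. -/
theorem VolumeForm.density_transition (μ : VolumeForm n M) (x₀ x₁ : M) {y : 𝔼}
    (hy : y ∈ ((chartAt 𝔼 x₀).symm ≫ₕ chartAt 𝔼 x₁).source) :
    μ.density x₀ y =
      (fderiv ℝ (transition x₀ x₁) y).det * μ.density x₁ (transition x₀ x₁ y) := by
  rw [density, formInChart_transition _ x₀ x₁ hy,
    ContinuousAlternatingMap.compContinuousLinearMap_apply, topForm_eq_smul_det, mul_comm]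
  congr 1
  have := (EuclideanSpace.basisFun (Fin n) ℝ).toBasis.det_comp
    (fderiv ℝ (transition x₀ x₁) y : 𝔼 →ₗ[ℝ] 𝔼) (EuclideanSpace.basisFun (Fin n) ℝ)
  rw [← OrthonormalBasis.coe_toBasis, Module.Basis.det_self, mul_one] at this
  rw [← OrthonormalBasis.coe_toBasis]
  exact this

variable [MeasurableSpace M] [BorelSpace M]

theorem aemeasurable_chart_symm (x₀ : M) :
    AEMeasurable (chartAt 𝔼 x₀).symm (volume.restrict (chartAt 𝔼 x₀).target) :=
  (chartAt 𝔼 x₀).continuousOn_symm.aemeasurable (chartAt 𝔼 x₀).open_target.measurableSet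

theorem aemeasurable_chart_symm_withDensity (x₀ : M) (f : 𝔼 → ENNReal) :
    AEMeasurable (chartAt 𝔼 x₀).symm
      ((volume.restrict (chartAt 𝔼 x₀).target).withDensity f) :=
  (aemeasurable_chart_symm x₀).mono_ac (withDensity_absolutelyContinuous _ _)

theorem chartMeasure_apply (μ : VolumeForm n M) (x₀ : M) {S : Set M} (hS : MeasurableSet S) :
    chartMeasure μ x₀ S = ∫⁻ y in (chartAt 𝔼 x₀).symm ⁻¹' S ∩ (chartAt 𝔼 x₀).target,
      ENNReal.ofReal |μ.density x₀ y| := by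
  rw [chartMeasure, Measure.map_apply_of_aemeasurable (aemeasurable_chart_symm_withDensity x₀ _) hS,
    withDensity_apply', Measure.restrict_restrict' (chartAt 𝔼 x₀).open_target.measurableSet]
  rfl

theorem measurableSet_preimage_chart_symm (x₀ : M) {S : Set M} (hS : MeasurableSet S) :
    MeasurableSet ((chartAt 𝔼 x₀).symm ⁻¹' S ∩ (chartAt 𝔼 x₀).target) := by
  have h1 : Measurable ((chartAt 𝔼 x₀).target.domRestrict (chartAt 𝔼 x₀).symm) :=
    (continuousOn_iff_continuous_domRestrict.1 (chartAt 𝔼 x₀).continuousOn_symm).measurable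
  have h2 := (chartAt 𝔼 x₀).open_target.measurableSet.subtype_image (h1 hS)
  convert h2 using 1
  ext y
  simp [and_comm]

/-- The change of variables formula for the transition map: its factor `|det|` is exactly the ratio
of the absolute densities, whatever the orientations of the two charts. -/
theorem chartMeasure_apply_eq (μ : VolumeForm n M) (x₀ x₁ : M) {S : Set M} (hS : MeasurableSet S)
    (h₀ : S ⊆ (chartAt 𝔼 x₀).source) (h₁ : S ⊆ (chartAt 𝔼 x₁).source) :
    chartMeasure μ x₀ S = chartMeasure μ x₁ S := by
  rw [chartMeasure_apply μ x₀ hS, chartMeasure_apply μ x₁ hS]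
  set A := (chartAt 𝔼 x₀).symm ⁻¹' S ∩ (chartAt 𝔼 x₀).target with hA
  have hsub : A ⊆ ((chartAt 𝔼 x₀).symm ≫ₕ chartAt 𝔼 x₁).source :=
    fun y hy ↦ ⟨hy.2, h₁ hy.1⟩
  have himg : transition x₀ x₁ '' A = (chartAt 𝔼 x₁).symm ⁻¹' S ∩ (chartAt 𝔼 x₁).target := by
    ext z
    constructor
    · rintro ⟨y, hy, rfl⟩
      refine ⟨?_, (chartAt 𝔼 x₁).map_source (h₁ hy.1)⟩
      rw [mem_preimage, transition_comp_chart_symm x₀ x₁ (hsub hy)]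
      exact hy.1
    · rintro ⟨hz, hz'⟩
      refine ⟨chartAt 𝔼 x₀ ((chartAt 𝔼 x₁).symm z), ⟨?_, (chartAt 𝔼 x₀).map_source (h₀ hz)⟩, ?_⟩
      · rw [mem_preimage, (chartAt 𝔼 x₀).left_inv (h₀ hz)]
        exact hz
      · simp only [transition, Function.comp_apply]
        rw [(chartAt 𝔼 x₀).left_inv (h₀ hz), (chartAt 𝔼 x₁).right_inv hz']
  have hinj : InjOn (transition x₀ x₁) A := fun y hy z hz h ↦
    ((chartAt 𝔼 x₀).symm ≫ₕ chartAt 𝔼 x₁).injOn (hsub hy) (hsub hz) h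
  rw [← himg, lintegral_image_eq_lintegral_abs_det_fderiv_mul volume
    (measurableSet_preimage_chart_symm x₀ hS) (f' := fderiv ℝ (transition x₀ x₁)) ?_ hinj]
  · refine setLIntegral_congr_fun (measurableSet_preimage_chart_symm x₀ hS) fun y hy ↦ ?_
    rw [μ.density_transition x₀ x₁ (hsub hy), abs_mul, ENNReal.ofReal_mul (abs_nonneg _)]
  · intro y hy
    have hS := ((chartAt 𝔼 x₀).symm ≫ₕ chartAt 𝔼 x₁).open_source.mem_nhds (hsub hy)
    exact (((contDiffOn_transition x₀ x₁).contDiffAt hS).differentiableAt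
      (by simp)).hasFDerivAt.hasFDerivWithinAt

variable [Nonempty M] [SecondCountableTopology M]

/-- Frees the measure from the countable cover chosen in its definition. -/
theorem volumeMeasure_apply_of_subset_source (μ : VolumeForm n M) (x₀ : M) {S : Set M}
    (hS : MeasurableSet S) (h₀ : S ⊆ (chartAt 𝔼 x₀).source) :
    volumeMeasure μ S = chartMeasure μ x₀ S := by
  set c := (exists_countable_charts n M).choose with hc
  have hcov : ⋃ k, (chartAt 𝔼 (c k)).source = univ := (exists_countable_charts n M).choose_spec
  set D := disjointed (fun j ↦ (chartAt 𝔼 (c j)).source) with hD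
  have hDm : ∀ k, MeasurableSet (D k) :=
    MeasurableSet.disjointed fun j ↦ (chartAt 𝔼 (c j)).open_source.measurableSet
  have hDsub : ∀ k, D k ⊆ (chartAt 𝔼 (c k)).source := fun k ↦ disjointed_le _ k
  have hDcov : ⋃ k, D k = univ := by rw [hD, iUnion_disjointed, hcov]
  have hDdis : Pairwise (Function.onFun Disjoint D) := disjoint_disjointed _
  -- The piece `S ∩ D k` lies in the domains of both charts, so its measure may be computed at `x₀`
  -- instead of `c k`; countable additivity then reassembles `S`.
  have h1 : volumeMeasure μ S = ∑' k, chartMeasure μ x₀ (S ∩ D k) := by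
    rw [volumeMeasure, Measure.sum_apply _ hS]
    refine tsum_congr fun k ↦ ?_
    rw [Measure.restrict_apply hS]
    exact chartMeasure_apply_eq μ _ _ (hS.inter (hDm k)) (inter_subset_right.trans (hDsub k))
      (inter_subset_left.trans h₀)
  rw [h1, ← measure_iUnion (fun i j hij ↦ (hDdis hij).mono inter_subset_right inter_subset_right)
    (fun k ↦ hS.inter (hDm k)), ← inter_iUnion, hDcov, inter_univ]

theorem volumeMeasure_restrict_source (μ : VolumeForm n M) (x₀ : M) :
    (volumeMeasure μ).restrict (chartAt 𝔼 x₀).source = chartMeasure μ x₀ := by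
  ext S hS
  have hsm := (chartAt 𝔼 x₀).open_source.measurableSet
  rw [Measure.restrict_apply hS, volumeMeasure_apply_of_subset_source μ x₀ (hS.inter hsm)
    inter_subset_right, chartMeasure_apply μ x₀ (hS.inter hsm), chartMeasure_apply μ x₀ hS]
  congr 2
  ext y
  simp only [mem_inter_iff, mem_preimage]
  exact ⟨fun h ↦ ⟨h.1.1, h.2⟩, fun h ↦ ⟨⟨h.1, (chartAt 𝔼 x₀).map_target h.2⟩, h.2⟩⟩

theorem VolumeForm.aemeasurable_ofReal_density (μ : VolumeForm n M) (x₀ : M) :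
    AEMeasurable (fun y ↦ ENNReal.ofReal |μ.density x₀ y|)
      (volume.restrict (chartAt 𝔼 x₀).target) :=
  ((μ.contDiffOn_density x₀).continuousOn.aemeasurable
    (chartAt 𝔼 x₀).open_target.measurableSet).abs.ennreal_ofReal

/-- The integral of a function supported in a chart domain, computed in the chart. -/
theorem integral_volumeMeasure_eq (μ : VolumeForm n M) (x₀ : M) {f : M → ℝ}
    (hf : ContinuousOn f (chartAt 𝔼 x₀).source)
    (hsupp : ∀ x ∉ (chartAt 𝔼 x₀).source, f x = 0) :
    ∫ x, f x ∂(volumeMeasure μ) =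
      ∫ y in (chartAt 𝔼 x₀).target, |μ.density x₀ y| * f ((chartAt 𝔼 x₀).symm y) := by
  have hsm := (chartAt 𝔼 x₀).open_source.measurableSet
  have hae : AEStronglyMeasurable f (chartMeasure μ x₀) := by
    rw [← volumeMeasure_restrict_source]
    exact hf.aestronglyMeasurable hsm
  rw [← setIntegral_eq_integral_of_forall_compl_eq_zero hsupp, volumeMeasure_restrict_source]
  rw [chartMeasure] at hae ⊢
  rw [integral_map (aemeasurable_chart_symm_withDensity x₀ _) hae]
  change ∫ y, f ((chartAt 𝔼 x₀).symm y) ∂((volume.restrict (chartAt 𝔼 x₀).target).withDensity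
    fun y ↦ ENNReal.ofReal |μ.density x₀ y|) = _
  rw [integral_withDensity_eq_integral_toReal_smul₀ (μ.aemeasurable_ofReal_density x₀)
    (by simp)]
  simp only [smul_eq_mul, ENNReal.toReal_ofReal (abs_nonneg _)]

/-- The density is continuous, hence bounded on a small coordinate ball. This is what makes
continuous compactly supported functions integrable below. -/
theorem isLocallyFiniteMeasure_volumeMeasure (μ : VolumeForm n M) :
    IsLocallyFiniteMeasure (volumeMeasure μ) := by
  refine ⟨fun x ↦ ?_⟩
  set e := chartAt 𝔼 x
  have hx := mem_chart_target 𝔼 x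
  have hc : ContinuousAt (μ.density x) (e x) :=
    (μ.contDiffOn_density x).continuousOn.continuousAt (e.open_target.mem_nhds hx)
  obtain ⟨r, hr, hball⟩ := Metric.mem_nhds_iff.1 (Filter.inter_mem (e.open_target.mem_nhds hx)
    (hc.abs.eventually_lt_const (lt_add_one _)))
  refine ⟨e.source ∩ e ⁻¹' Metric.ball (e x) r,
    (e.isOpen_inter_preimage Metric.isOpen_ball).mem_nhds
      ⟨mem_chart_source 𝔼 x, Metric.mem_ball_self hr⟩, ?_⟩
  have hm : MeasurableSet (e.source ∩ e ⁻¹' Metric.ball (e x) r) :=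
    (e.isOpen_inter_preimage Metric.isOpen_ball).measurableSet
  rw [volumeMeasure_apply_of_subset_source μ x hm inter_subset_left, chartMeasure_apply μ x hm]
  have hsub : e.symm ⁻¹' (e.source ∩ e ⁻¹' Metric.ball (e x) r) ∩ e.target ⊆
      Metric.ball (e x) r := by
    rintro y ⟨hy, hy'⟩
    have := hy.2
    rwa [mem_preimage, e.right_inv hy'] at this
  calc _ ≤ ∫⁻ y in Metric.ball (e x) r, ENNReal.ofReal |μ.density x y| :=
        lintegral_mono_set hsub
    _ ≤ ∫⁻ y in Metric.ball (e x) r, ENNReal.ofReal (|μ.density x (e x)| + 1) :=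
        setLIntegral_mono measurable_const fun y hy ↦
          ENNReal.ofReal_le_ofReal (le_of_lt (hball hy).2)
    _ < ⊤ := by
        rw [setLIntegral_const]
        exact ENNReal.mul_lt_top ENNReal.ofReal_lt_top measure_ball_lt_top

/-- The density has no zeros, so a null open set would have a Lebesgue-null open image in a chart.
This allows continuous functions that agree almost everywhere to be identified. -/
theorem isOpenPosMeasure_volumeMeasure (μ : VolumeForm n M) :
    (volumeMeasure μ).IsOpenPosMeasure := by
  refine ⟨fun U hU ⟨x, hx⟩ h0 ↦ ?_⟩
  set e := chartAt 𝔼 x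
  have hUe : IsOpen (U ∩ e.source) := hU.inter e.open_source
  have h1 : volumeMeasure μ (U ∩ e.source) = 0 := measure_mono_null inter_subset_left h0
  rw [volumeMeasure_apply_of_subset_source μ x hUe.measurableSet inter_subset_right,
    chartMeasure_apply μ x hUe.measurableSet,
    setLIntegral_eq_zero_iff' (measurableSet_preimage_chart_symm x hUe.measurableSet)
      ((μ.aemeasurable_ofReal_density x).mono_measure
        (Measure.restrict_mono inter_subset_right le_rfl))] at h1
  have hO : IsOpen (e.symm ⁻¹' (U ∩ e.source) ∩ e.target) := by
    rw [inter_comm]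
    exact e.symm.isOpen_inter_preimage hUe
  have hpos : volume (e.symm ⁻¹' (U ∩ e.source) ∩ e.target) ≠ 0 := by
    refine hO.measure_ne_zero _ ⟨e x, ?_, mem_chart_target 𝔼 x⟩
    rw [mem_preimage, e.left_inv (mem_chart_source 𝔼 x)]
    exact ⟨hx, mem_chart_source 𝔼 x⟩
  apply hpos
  refine measure_mono_null (fun y hy ↦ ?_) h1
  intro h
  exact μ.density_ne_zero x hy.2 (by simpa using h hy)

end Measure

/-! ### The divergence in coordinates and the divergence theorem in one chart. -/

section Divergence

variable {n : ℕ} {M : Type*} [TopologicalSpace M] [ChartedSpace (EuclideanSpace ℝ (Fin n)) M]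
  [IsManifold (𝓡 n) ∞ M]

local notation "𝔼" => EuclideanSpace ℝ (Fin n)

/-- A vector field is smooth if it is so in all preferred charts. -/
def SmoothField (X : ∀ x : M, TangentSpace (𝓡 n) x) : Prop :=
  ∀ x₀ : M, ContDiffOn ℝ ∞ (fieldInChart X x₀) (chartAt (EuclideanSpace ℝ (Fin n)) x₀).target

/-- The divergence of a vector field, computed in the preferred chart at `x₀`. -/
def chartDivergence (μ : VolumeForm n M) (X : ∀ x : M, TangentSpace (𝓡 n) x) (x₀ : M)
    (y : EuclideanSpace ℝ (Fin n)) : ℝ :=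
  (∑ i, fderiv ℝ (fun z ↦ μ.density x₀ z * fieldInChart X x₀ z i) y
    (EuclideanSpace.basisFun (Fin n) ℝ i)) / μ.density x₀ y

/-- Expand `X` in the basis: every term other than the `i`-th puts a repeated vector into an
alternating form. -/
theorem topForm_update_basis (α : 𝔼 [⋀^Fin n]→L[ℝ] ℝ) (i : Fin n) (X : 𝔼) :
    α (Function.update (EuclideanSpace.basisFun (Fin n) ℝ) i X) =
      X i * α (EuclideanSpace.basisFun (Fin n) ℝ) := by
  set e : Fin n → 𝔼 := ⇑(EuclideanSpace.basisFun (Fin n) ℝ) with he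
  have hX : X = ∑ j, X j • e j := by
    exact ((EuclideanSpace.basisFun (Fin n) ℝ).sum_repr X).symm
  have h := map_sum (α.toContinuousLinearMap e i) (fun j ↦ X j • e j) Finset.univ
  rw [← hX] at h
  change α (Function.update e i X) = _ at h
  rw [h, Finset.sum_eq_single i]
  · rw [map_smul]
    change X i • α (Function.update e i (e i)) = _
    rw [Function.update_eq_self, smul_eq_mul]
  · intro j _ hj
    rw [map_smul]
    change X j • α (Function.update e i (e j)) = 0
    rw [α.map_eq_zero_of_eq _ (i := i) (j := j) (by simp [hj]) hj.symm, smul_zero]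
  · simp

/-- Moving `X` from the front to slot `i` takes `i` transpositions. The resulting sign cancels the
one in the alternating sum for the exterior derivative. -/
theorem topForm_vecCons_removeNth {m : ℕ}
    (α : EuclideanSpace ℝ (Fin (m + 1)) [⋀^Fin (m + 1)]→L[ℝ] ℝ) (i : Fin (m + 1))
    (X : EuclideanSpace ℝ (Fin (m + 1))) :
    (-1) ^ (i : ℕ) * α (Matrix.vecCons X (i.removeNth (EuclideanSpace.basisFun (Fin (m + 1)) ℝ))) =
      X i * α (EuclideanSpace.basisFun (Fin (m + 1)) ℝ) := by
  have h := α.toAlternatingMap.map_insertNth i X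
    (i.removeNth (EuclideanSpace.basisFun (Fin (m + 1)) ℝ))
  rw [Fin.insertNth_removeNth] at h
  have h2 := topForm_update_basis α i X
  rw [zsmul_eq_mul, Int.cast_pow, Int.cast_neg, Int.cast_one] at h
  exact h.symm.trans h2

theorem _root_.DifferentiableAt.curryLeft {E E' : Type*} [NormedAddCommGroup E] [NormedSpace ℝ E]
    [NormedAddCommGroup E'] [NormedSpace ℝ E'] {m : ℕ} {g : E' → E [⋀^Fin (m + 1)]→L[ℝ] ℝ}
    {y : E'} (hg : DifferentiableAt ℝ g y) : DifferentiableAt ℝ (fun z ↦ (g z).curryLeft) y := by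
  have h : IsBoundedLinearMap ℝ fun f : E [⋀^Fin (m + 1)]→L[ℝ] ℝ ↦ f.curryLeft :=
    ⟨⟨fun f g ↦ f.curryLeft_add g, fun c f ↦ f.curryLeft_smul c⟩, 1, one_pos, fun f ↦ by
      rw [one_mul]
      exact f.norm_curryLeft.le⟩
  have h' := @IsBoundedLinearMap.differentiableAt ℝ _ (E [⋀^Fin (m + 1)]→L[ℝ] ℝ) _ _
    (E →L[ℝ] E [⋀^Fin m]→L[ℝ] ℝ) _ _ _ (g y) h
  exact @DifferentiableAt.comp ℝ _ E' _ _ (E [⋀^Fin (m + 1)]→L[ℝ] ℝ) _ _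
    (E →L[ℝ] E [⋀^Fin m]→L[ℝ] ℝ) _ _ g y _ h' hg

theorem SmoothField.contDiffOn_density_mul {X : ∀ x : M, TangentSpace (𝓡 n) x}
    (hX : SmoothField X) (μ : VolumeForm n M) (x₀ : M) (i : Fin n) :
    ContDiffOn ℝ ∞ (fun z ↦ μ.density x₀ z * fieldInChart X x₀ z i) (chartAt 𝔼 x₀).target :=
  (μ.contDiffOn_density x₀).mul
    ((EuclideanSpace.proj (𝕜 := ℝ) i).contDiff.comp_contDiffOn (hX x₀))

theorem SmoothField.continuousOn_chartDivergence {X : ∀ x : M, TangentSpace (𝓡 n) x}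
    (hX : SmoothField X) (μ : VolumeForm n M) (x₀ : M) :
    ContinuousOn (chartDivergence μ X x₀) (chartAt 𝔼 x₀).target := by
  refine ContinuousOn.div (continuousOn_finsetSum _ fun i _ ↦ ?_)
    (μ.contDiffOn_density x₀).continuousOn fun y hy ↦ μ.density_ne_zero x₀ hy
  exact ((hX.contDiffOn_density_mul μ x₀ i).continuousOn_fderiv_of_isOpen
    (chartAt 𝔼 x₀).open_target (by simp)).clm_apply continuousOn_const

/-- Evaluate `d(i_X μ) = (div X) μ` on the standard basis. Only the chart centred at `x` itself is
covered here, since that is the one used to define the divergence at `x`. -/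
theorem divergence_eq_chartDivergence {m : ℕ} {N : Type*} [TopologicalSpace N]
    [ChartedSpace (EuclideanSpace ℝ (Fin (m + 1))) N] [IsManifold (𝓡 (m + 1)) ∞ N]
    (μ : VolumeForm (m + 1) N) {X : ∀ x : N, TangentSpace (𝓡 (m + 1)) x} (hX : SmoothField X)
    (x : N) : divergence μ X x =
      chartDivergence μ X x (chartAt (EuclideanSpace ℝ (Fin (m + 1))) x x) := by
  set e := chartAt (EuclideanSpace ℝ (Fin (m + 1))) x
  have hy := mem_chart_target (EuclideanSpace ℝ (Fin (m + 1))) x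
  have hn := e.open_target.mem_nhds hy
  have h1 : extDeriv (fun y ↦ (formInChart μ.toFun x y).curryLeft (fieldInChart X x y)) (e x) =
      divergence μ X x • formInChart μ.toFun x (e x) :=
    (existsUnique_topForm _ _ (μ.inChart_ne_zero x)).choose_spec.1
  have hd : DifferentiableAt ℝ
      (fun y ↦ (formInChart μ.toFun x y).curryLeft (fieldInChart X x y)) (e x) := by
    have hf : DifferentiableAt ℝ (formInChart μ.toFun x) (e x) :=
      ((μ.smooth x).contDiffAt hn).differentiableAt (by simp)
    have hg : DifferentiableAt ℝ (fieldInChart X x) (e x) :=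
      ((hX x).contDiffAt hn).differentiableAt (by simp)
    have hc : DifferentiableAt ℝ (fun y ↦ (formInChart μ.toFun x y).curryLeft) (e x) :=
      hf.curryLeft
    exact hc.clm_apply hg
  have h2 := DFunLike.congr_fun h1 (⇑(EuclideanSpace.basisFun (Fin (m + 1)) ℝ))
  rw [extDeriv_apply hd] at h2
  rw [chartDivergence, eq_div_iff (μ.density_ne_zero x hy)]
  refine h2.symm.trans (Finset.sum_congr rfl fun i _ ↦ ?_)
  have h3 : (fun y ↦ μ.density x y * fieldInChart X x y i) = fun y ↦ (-1 : ℝ) ^ (i : ℕ) *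
      ((formInChart μ.toFun x y).curryLeft (fieldInChart X x y))
        (i.removeNth (EuclideanSpace.basisFun (Fin (m + 1)) ℝ)) := by
    funext y
    rw [mul_comm]
    exact (topForm_vecCons_removeNth _ i _).symm
  rw [h3]
  have h4 : DifferentiableAt ℝ (fun y ↦
      ((formInChart μ.toFun x y).curryLeft (fieldInChart X x y))
        (i.removeNth (EuclideanSpace.basisFun (Fin (m + 1)) ℝ))) (e x) :=
    (ContinuousAlternatingMap.apply ℝ (EuclideanSpace ℝ (Fin (m + 1))) ℝ
      (i.removeNth (EuclideanSpace.basisFun (Fin (m + 1)) ℝ) :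
        Fin m → EuclideanSpace ℝ (Fin (m + 1)))).differentiableAt.comp (e x) hd
  rw [fderiv_const_mul h4]
  simp

/-- Extension by zero: near a point of `K` the function is `h`, and near a point off `K` it vanishes
on both sides of the boundary of `O`. -/
theorem contDiff_indicator_of_tsupport {O : Set 𝔼} (hO : IsOpen O) {K : Set 𝔼} (hK : IsClosed K)
    (hKO : K ⊆ O) {h : 𝔼 → ℝ} (hh : ContDiffOn ℝ ∞ h O) (h0 : ∀ y ∈ O, y ∉ K → h y = 0) :
    ContDiff ℝ ∞ (O.indicator h) := by
  rw [contDiff_iff_contDiffAt]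
  intro y
  by_cases hy : y ∈ K
  · refine (hh.contDiffAt (hO.mem_nhds (hKO hy))).congr_of_eventuallyEq ?_
    filter_upwards [hO.mem_nhds (hKO hy)] with z hz
    simp [hz]
  · refine (contDiffAt_const (c := (0 : ℝ))).congr_of_eventuallyEq ?_
    filter_upwards [hK.isOpen_compl.mem_nhds hy] with z hz
    by_cases hz' : z ∈ O
    · simp [hz', h0 z hz' hz]
    · simp [hz']

/-- The integral of a partial derivative of a compactly supported function vanishes. -/
theorem integral_fderiv_eq_zero_of_hasCompactSupport {h : 𝔼 → ℝ} (hh : ContDiff ℝ ∞ h)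
    (hc : HasCompactSupport h) (v : 𝔼) : ∫ y, fderiv ℝ h y v = 0 := by
  have hcont : Continuous fun y ↦ fderiv ℝ h y v :=
    (hh.continuous_fderiv (by simp)).clm_apply continuous_const
  have hcs : HasCompactSupport fun y ↦ fderiv ℝ h y v := by
    refine (hc.fderiv (𝕜 := ℝ)).mono fun y hy ↦ ?_
    simp only [Function.mem_support] at hy ⊢
    intro h0
    rw [h0] at hy
    exact hy rfl
  -- Integration by parts against the constant function `1`, whose derivative is zero.
  have := integral_mul_fderiv_eq_neg_fderiv_mul_of_integrable (μ := volume) (f := fun _ : 𝔼 ↦ (1 : ℝ))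
    (g := h) (v := v) (by simp) (by simpa using hcont.integrable_of_hasCompactSupport hcs)
    (by simpa using hh.continuous.integrable_of_hasCompactSupport hc) (by simp)
    (fun x _ ↦ (hh.differentiable (by simp)).differentiableAt)
  simpa using this

/-- A continuous function without zeros has locally constant sign. The sign `s` is only local
because a chart domain need not be connected. -/
theorem VolumeForm.eventually_abs_density (μ : VolumeForm n M) (x₀ : M) {y : 𝔼}
    (hy : y ∈ (chartAt 𝔼 x₀).target) :
    ∃ s : ℝ, ∀ᶠ z in nhds y, |μ.density x₀ z| = s * μ.density x₀ z := by
  have hc : ContinuousAt (μ.density x₀) y :=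
    (μ.contDiffOn_density x₀).continuousOn.continuousAt ((chartAt 𝔼 x₀).open_target.mem_nhds hy)
  rcases lt_or_gt_of_ne (μ.density_ne_zero x₀ hy) with h | h
  · refine ⟨-1, ?_⟩
    filter_upwards [hc.eventually_lt_const h] with z hz
    rw [abs_of_neg hz]; ring
  · refine ⟨1, ?_⟩
    filter_upwards [hc.eventually_const_lt h] with z hz
    rw [abs_of_pos hz]; ring

theorem VolumeForm.contDiffOn_abs_density (μ : VolumeForm n M) (x₀ : M) :
    ContDiffOn ℝ ∞ (fun y ↦ |μ.density x₀ y|) (chartAt 𝔼 x₀).target := by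
  intro y hy
  obtain ⟨s, hs⟩ := μ.eventually_abs_density x₀ hy
  exact ((contDiffAt_const.mul ((μ.contDiffOn_density x₀).contDiffAt
    ((chartAt 𝔼 x₀).open_target.mem_nhds hy))).congr_of_eventuallyEq hs).contDiffWithinAt

/-- The divergence theorem in a chart, for a function with compact support in it. -/
theorem setIntegral_chartDivergence (μ : VolumeForm n M) {X : ∀ x : M, TangentSpace (𝓡 n) x}
    (hX : SmoothField X) (x₀ : M) {g : 𝔼 → ℝ} {K : Set 𝔼} (hK : IsCompact K)
    (hKt : K ⊆ (chartAt 𝔼 x₀).target) (hg : ContDiffOn ℝ ∞ g (chartAt 𝔼 x₀).target)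
    (h0 : ∀ y ∈ (chartAt 𝔼 x₀).target, y ∉ K → g y = 0) :
    ∫ y in (chartAt 𝔼 x₀).target, |μ.density x₀ y| *
      (fderiv ℝ g y (fieldInChart X x₀ y) + g y * chartDivergence μ X x₀ y) = 0 := by
  set O := (chartAt 𝔼 x₀).target with hOdef
  have hO : IsOpen O := (chartAt 𝔼 x₀).open_target
  -- The components of `|ρ| g X`: the integrand in the claim is the Euclidean divergence of this
  -- field, which extends by zero to a smooth compactly supported field on the whole space.
  set h : Fin n → 𝔼 → ℝ := fun i y ↦ |μ.density x₀ y| * (g y * fieldInChart X x₀ y i) with hh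
  have hXi : ∀ i, ContDiffOn ℝ ∞ (fun y ↦ fieldInChart X x₀ y i) O := fun i ↦
    (EuclideanSpace.proj (𝕜 := ℝ) i).contDiff.comp_contDiffOn (hX x₀)
  have hsm : ∀ i, ContDiffOn ℝ ∞ (h i) O := fun i ↦
    (μ.contDiffOn_abs_density x₀).mul (hg.mul (hXi i))
  have hh0 : ∀ i, ∀ y ∈ O, y ∉ K → h i y = 0 := fun i y hy hyK ↦ by simp [hh, h0 y hy hyK]
  have hS : ∀ i, ContDiff ℝ ∞ (O.indicator (h i)) := fun i ↦
    contDiff_indicator_of_tsupport hO hK.isClosed hKt (hsm i) (hh0 i)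
  have hcs : ∀ i, HasCompactSupport (O.indicator (h i)) := fun i ↦
    HasCompactSupport.intro hK fun y hy ↦ by
      by_cases hyO : y ∈ O
      · simp [hyO, hh0 i y hyO hy]
      · simp [hyO]
  have hzero := fun i ↦ integral_fderiv_eq_zero_of_hasCompactSupport (hS i) (hcs i)
    (EuclideanSpace.basisFun (Fin n) ℝ i)
  have hint : ∀ i, Integrable fun y ↦ fderiv ℝ (O.indicator (h i)) y
      (EuclideanSpace.basisFun (Fin n) ℝ i) := fun i ↦ by
    refine (((hS i).continuous_fderiv (by simp)).clm_apply
      continuous_const).integrable_of_hasCompactSupport ?_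
    refine ((hcs i).fderiv (𝕜 := ℝ)).mono fun y hy ↦ ?_
    simp only [Function.mem_support] at hy ⊢
    intro h0
    rw [h0] at hy
    exact hy rfl
  have hout : ∀ i, ∀ y ∉ O, fderiv ℝ (O.indicator (h i)) y
      (EuclideanSpace.basisFun (Fin n) ℝ i) = 0 := fun i y hy ↦ by
    have hev : O.indicator (h i) =ᶠ[nhds y] fun _ ↦ 0 := by
      filter_upwards [hK.isClosed.isOpen_compl.mem_nhds fun hyK ↦ hy (hKt hyK)] with z hz
      by_cases hz' : z ∈ O
      · simp [hz', hh0 i z hz' hz]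
      · simp [hz']
    rw [hev.fderiv_eq]
    simp
  have hsum : ∫ y in O, ∑ i, fderiv ℝ (O.indicator (h i)) y
      (EuclideanSpace.basisFun (Fin n) ℝ i) = 0 := by
    rw [integral_finsetSum _ fun i _ ↦ (hint i).integrableOn]
    refine Finset.sum_eq_zero fun i _ ↦ ?_
    rw [setIntegral_eq_integral_of_forall_compl_eq_zero (hout i), hzero i]
  rw [← hsum]
  refine setIntegral_congr_fun hO.measurableSet fun y hy ↦ ?_
  obtain ⟨s, hs⟩ := μ.eventually_abs_density x₀ hy
  have hyn := hO.mem_nhds hy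
  have hgd : DifferentiableAt ℝ g y := (hg.contDiffAt hyn).differentiableAt (by simp)
  have hpd : ∀ i, DifferentiableAt ℝ (fun z ↦ μ.density x₀ z * fieldInChart X x₀ z i) y :=
    fun i ↦ ((hX.contDiffOn_density_mul μ x₀ i).contDiffAt hyn).differentiableAt (by simp)
  -- Near `y` the absolute value is multiplication by the constant `s`, so the product rule applies
  -- to `s · g · (ρ Xᵢ)`.
  have hterm : ∀ i, fderiv ℝ (O.indicator (h i)) y (EuclideanSpace.basisFun (Fin n) ℝ i) =
      s * (g y * fderiv ℝ (fun z ↦ μ.density x₀ z * fieldInChart X x₀ z i) y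
        (EuclideanSpace.basisFun (Fin n) ℝ i) + μ.density x₀ y * fieldInChart X x₀ y i *
        fderiv ℝ g y (EuclideanSpace.basisFun (Fin n) ℝ i)) := fun i ↦ by
    have hev : O.indicator (h i) =ᶠ[nhds y]
        fun z ↦ s * (g z * (μ.density x₀ z * fieldInChart X x₀ z i)) := by
      filter_upwards [hyn, hs] with z hz hz'
      simp only [hz, indicator_of_mem, hh, hz']
      ring
    have hprod : HasFDerivAt (fun z ↦ s * (g z * (μ.density x₀ z * fieldInChart X x₀ z i))) _ y :=
      (hgd.hasFDerivAt.fun_mul (hpd i).hasFDerivAt).const_mul s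
    rw [hev.fderiv_eq, hprod.fderiv]
    simp
    ring
  have hXsum : fderiv ℝ g y (fieldInChart X x₀ y) = ∑ i, fieldInChart X x₀ y i *
      fderiv ℝ g y (EuclideanSpace.basisFun (Fin n) ℝ i) := by
    conv_lhs => rw [← (EuclideanSpace.basisFun (Fin n) ℝ).sum_repr (fieldInChart X x₀ y)]
    simp
  simp only [hterm]
  rw [← Finset.mul_sum, Finset.sum_add_distrib, ← Finset.mul_sum, hs.self_of_nhds, hXsum,
    chartDivergence]
  simp only [mul_assoc]
  rw [← Finset.mul_sum]
  field_simp [μ.density_ne_zero x₀ hy]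
  ring

end Divergence

/-! ### From one chart to the manifold: calculus of differentials, chart independence, partition of
unity. -/

section DivergenceTheorem

variable {n : ℕ} {M : Type*} [TopologicalSpace M] [ChartedSpace (EuclideanSpace ℝ (Fin n)) M]
  [IsManifold (𝓡 n) ∞ M]

local notation "𝔼" => EuclideanSpace ℝ (Fin n)

theorem differential_add {F G : M → ℝ} {x : M} (hF : MDifferentiableAt (𝓡 n) 𝓘(ℝ, ℝ) F x)
    (hG : MDifferentiableAt (𝓡 n) 𝓘(ℝ, ℝ) G x) (v : TangentSpace (𝓡 n) x) :
    differential (fun z ↦ F z + G z) x v = differential F x v + differential G x v :=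
  DFunLike.congr_fun (hF.hasMFDerivAt.add hG.hasMFDerivAt).mfderiv v

theorem differential_sum {ι : Type*} (s : Finset ι) {g : ι → M → ℝ} {x : M}
    (hg : ∀ i ∈ s, MDifferentiableAt (𝓡 n) 𝓘(ℝ, ℝ) (g i) x) (v : TangentSpace (𝓡 n) x) :
    differential (fun z ↦ ∑ i ∈ s, g i z) x v = ∑ i ∈ s, differential (g i) x v := by
  classical
  -- Differentiability of the partial sums is carried through the induction, because additivity of
  -- the differential requires it.
  have h : MDifferentiableAt (𝓡 n) 𝓘(ℝ, ℝ) (fun z ↦ ∑ i ∈ s, g i z) x ∧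
      differential (fun z ↦ ∑ i ∈ s, g i z) x v = ∑ i ∈ s, differential (g i) x v := by
    induction s using Finset.induction_on with
    | empty =>
      simp only [Finset.sum_empty]
      exact ⟨mdifferentiableAt_const, DFunLike.congr_fun mfderiv_const v⟩
    | insert i s hi ih =>
      obtain ⟨h1, h2⟩ := ih fun j hj ↦ hg j (Finset.mem_insert_of_mem hj)
      have h3 := hg i (Finset.mem_insert_self i s)
      simp only [Finset.sum_insert hi]
      exact ⟨h3.add h1, by rw [differential_add h3 h1, h2]⟩
  exact h.2

theorem differential_const_mul {G : M → ℝ} {x : M} (t : ℝ)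
    (hG : MDifferentiableAt (𝓡 n) 𝓘(ℝ, ℝ) G x) (v : TangentSpace (𝓡 n) x) :
    differential (fun z ↦ t * G z) x v = t * differential G x v :=
  DFunLike.congr_fun (hG.hasMFDerivAt.const_smul t).mfderiv v

theorem differential_eq_zero_of_notMem_tsupport {G : M → ℝ} {x : M} (hx : x ∉ tsupport G) :
    differential (n := n) G x = 0 := by
  have h : G =ᶠ[nhds x] fun _ ↦ (0 : ℝ) := notMem_tsupport_iff_eventuallyEq.1 hx
  rw [differential, h.mfderiv_eq]
  exact mfderiv_const

theorem continuous_differential_apply {X : ∀ x : M, TangentSpace (𝓡 n) x} (hX : SmoothField X)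
    {G : M → ℝ} (hG : ContMDiff (𝓡 n) 𝓘(ℝ, ℝ) ∞ G) :
    Continuous fun x ↦ differential G x (X x) := by
  rw [continuous_iff_continuousAt]
  intro x₀
  set e := chartAt 𝔼 x₀
  have hev : (fun x ↦ differential G x (X x)) =ᶠ[nhds x₀]
      fun x ↦ fderiv ℝ (G ∘ e.symm) (e x) (fieldInChart X x₀ (e x)) := by
    filter_upwards [e.open_source.mem_nhds (mem_chart_source 𝔼 x₀)] with x hx
    rw [fieldInChart_chart hx, differential_eq_fderiv hx (hG.mdifferentiableAt (by simp))]
  refine ContinuousAt.congr ?_ hev.symm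
  have hc : ContinuousOn (fun y ↦ fderiv ℝ (G ∘ e.symm) y (fieldInChart X x₀ y)) e.target :=
    ((contDiffOn_comp_chart_symm hG x₀).continuousOn_fderiv_of_isOpen e.open_target
      (by simp)).clm_apply (hX x₀).continuousOn
  exact ContinuousAt.comp (g := fun y ↦ fderiv ℝ (G ∘ e.symm) y (fieldInChart X x₀ y))
    (hc.continuousAt (e.open_target.mem_nhds (mem_chart_target 𝔼 x₀)))
    (e.continuousAt (mem_chart_source 𝔼 x₀))

theorem hasCompactSupport_differential_apply [T2Space M] (X : ∀ x : M, TangentSpace (𝓡 n) x)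
    {G : M → ℝ} (hG : HasCompactSupport G) :
    HasCompactSupport fun x ↦ differential G x (X x) := by
  refine HasCompactSupport.of_support_subset_isCompact hG fun x hx ↦ ?_
  by_contra h
  exact hx (by simp [differential_eq_zero_of_notMem_tsupport h])

theorem continuousOn_chartDivergence_comp_chart (μ : VolumeForm n M)
    {X : ∀ x : M, TangentSpace (𝓡 n) x} (hX : SmoothField X) (x₀ : M) :
    ContinuousOn (fun x ↦ chartDivergence μ X x₀ (chartAt 𝔼 x₀ x)) (chartAt 𝔼 x₀).source :=
  (hX.continuousOn_chartDivergence μ x₀).comp (chartAt 𝔼 x₀).continuousOn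
    (chartAt 𝔼 x₀).mapsTo

/-- Makes products with a chart divergence continuous on all of `M`, although that divergence is
controlled only on the chart domain. -/
theorem continuous_mul_of_tsupport_subset {G u : M → ℝ} {U : Set M} (hU : IsOpen U)
    (hG : Continuous G) (hGU : tsupport G ⊆ U) (hu : ContinuousOn u U) :
    Continuous fun x ↦ G x * u x := by
  refine continuous_of_tsupport fun x hx ↦ ?_
  have hxU : x ∈ U := hGU (tsupport_mul_subset_left hx)
  exact hG.continuousAt.mul (hu.continuousAt (hU.mem_nhds hxU))

variable [T2Space M] [MeasurableSpace M] [BorelSpace M] [Nonempty M] [SecondCountableTopology M]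

/-- The divergence theorem in one chart, transported to `M`. It uses the divergence computed in the
chart at `x₀`, so it is available before chart independence and serves to prove it. -/
theorem integral_differential_add_mul_chartDivergence (μ : VolumeForm n M)
    {X : ∀ x : M, TangentSpace (𝓡 n) x} (hX : SmoothField X) (x₀ : M) {G : M → ℝ}
    (hG : ContMDiff (𝓡 n) 𝓘(ℝ, ℝ) ∞ G) (hGc : HasCompactSupport G)
    (hGs : tsupport G ⊆ (chartAt 𝔼 x₀).source) :
    ∫ x, (differential G x (X x) + G x * chartDivergence μ X x₀ (chartAt 𝔼 x₀ x))
      ∂(volumeMeasure μ) = 0 := by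
  set e := chartAt 𝔼 x₀
  have hc : ContinuousOn (fun x ↦ differential G x (X x) + G x * chartDivergence μ X x₀ (e x))
      e.source :=
    (continuous_differential_apply hX hG).continuousOn.add
      (hG.continuous.continuousOn.mul (continuousOn_chartDivergence_comp_chart μ hX x₀))
  rw [integral_volumeMeasure_eq μ x₀ hc]
  · have hK : IsCompact (e '' tsupport G) := hGc.isCompact.image_of_continuousOn
      (e.continuousOn.mono hGs)
    have hKt : e '' tsupport G ⊆ e.target := by
      rintro _ ⟨x, hx, rfl⟩
      exact e.map_source (hGs hx)
    rw [← setIntegral_chartDivergence μ hX x₀ hK hKt (contDiffOn_comp_chart_symm hG x₀)]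
    · refine setIntegral_congr_fun e.open_target.measurableSet fun y hy ↦ ?_
      have hx := e.map_target hy
      rw [differential_eq_fderiv hx (hG.mdifferentiableAt (by simp)), ← fieldInChart_chart hx,
        e.right_inv hy]
      rfl
    · intro y hy hyK
      by_contra h
      exact hyK ⟨e.symm y, subset_tsupport _ h, e.right_inv hy⟩
  · intro x hx
    have hx' : x ∉ tsupport G := fun h ↦ hx (hGs h)
    rw [differential_eq_zero_of_notMem_tsupport hx', image_eq_zero_of_notMem_tsupport hx']
    simp

/-- The divergence does not depend on the chart. -/
theorem chartDivergence_eq (μ : VolumeForm n M) {X : ∀ x : M, TangentSpace (𝓡 n) x}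
    (hX : SmoothField X) (x₀ x₁ : M) {x : M} (h₀ : x ∈ (chartAt 𝔼 x₀).source)
    (h₁ : x ∈ (chartAt 𝔼 x₁).source) :
    chartDivergence μ X x₀ (chartAt 𝔼 x₀ x) = chartDivergence μ X x₁ (chartAt 𝔼 x₁ x) := by
  have := isLocallyFiniteMeasure_volumeMeasure μ
  have := isOpenPosMeasure_volumeMeasure μ
  have : LocallyCompactSpace M := ChartedSpace.locallyCompactSpace 𝔼 M
  set u₀ : M → ℝ := fun x ↦ chartDivergence μ X x₀ (chartAt 𝔼 x₀ x)
  set u₁ : M → ℝ := fun x ↦ chartDivergence μ X x₁ (chartAt 𝔼 x₁ x)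
  set U := (chartAt 𝔼 x₀).source ∩ (chartAt 𝔼 x₁).source
  have hU : IsOpen U := (chartAt 𝔼 x₀).open_source.inter (chartAt 𝔼 x₁).open_source
  have hc₀ : ContinuousOn u₀ U :=
    (continuousOn_chartDivergence_comp_chart μ hX x₀).mono inter_subset_left
  have hc₁ : ContinuousOn u₁ U :=
    (continuousOn_chartDivergence_comp_chart μ hX x₁).mono inter_subset_right
  -- For test functions `G` supported in the overlap, both `∫ G u₀` and `∫ G u₁` equal `-∫ dG(X)`.
  -- Hence `u₀ = u₁` almost everywhere on `U`, and everywhere on `U` by continuity; no derivative of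
  -- a Jacobian is computed.
  have hae := hU.ae_eq_zero_of_integral_contMDiff_smul_eq_zero (𝓡 n) (f := fun x ↦ u₀ x - u₁ x)
    (μ := volumeMeasure μ) ((hc₀.sub hc₁).locallyIntegrableOn hU.measurableSet) ?_
  · have h := Measure.eqOn_open_of_ae_eq (μ := volumeMeasure μ) (f := u₀) (g := u₁) (U := U) ?_ hU
      hc₀ hc₁
    · exact h ⟨h₀, h₁⟩
    · rw [Filter.EventuallyEq, ae_restrict_iff' hU.measurableSet]
      filter_upwards [hae] with z hz hzU
      exact sub_eq_zero.1 (hz hzU)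
  · intro G hG hGc hGU
    have i0 : Integrable (fun x ↦ differential G x (X x)) (volumeMeasure μ) :=
      (continuous_differential_apply hX hG).integrable_of_hasCompactSupport
        (hasCompactSupport_differential_apply X hGc)
    have i1 : Integrable (fun x ↦ G x * u₀ x) (volumeMeasure μ) :=
      (continuous_mul_of_tsupport_subset hU hG.continuous hGU
        hc₀).integrable_of_hasCompactSupport hGc.mul_right
    have i2 : Integrable (fun x ↦ G x * u₁ x) (volumeMeasure μ) :=
      (continuous_mul_of_tsupport_subset hU hG.continuous hGU
        hc₁).integrable_of_hasCompactSupport hGc.mul_right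
    have e1 := integral_differential_add_mul_chartDivergence μ hX x₀ hG hGc
      (hGU.trans inter_subset_left)
    have e2 := integral_differential_add_mul_chartDivergence μ hX x₁ hG hGc
      (hGU.trans inter_subset_right)
    rw [integral_add i0 i1] at e1
    rw [integral_add i0 i2] at e2
    simp only [smul_eq_mul, mul_sub]
    rw [integral_sub i1 i2]
    linarith

/-- Multiply `G` by a partition of unity subordinate to the chart domains; by local finiteness only
finitely many members meet the compact support of `G`. -/
theorem exists_finset_sum_partition {G : M → ℝ} (hG : ContMDiff (𝓡 n) 𝓘(ℝ, ℝ) ∞ G)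
    (hGc : HasCompactSupport G) : ∃ (s : Finset M) (g : M → M → ℝ),
      (∀ i, ContMDiff (𝓡 n) 𝓘(ℝ, ℝ) ∞ (g i)) ∧ (∀ i, HasCompactSupport (g i)) ∧
      (∀ i, tsupport (g i) ⊆ (chartAt 𝔼 i).source) ∧ ∀ x, G x = ∑ i ∈ s, g i x := by
  have : LocallyCompactSpace M := ChartedSpace.locallyCompactSpace 𝔼 M
  obtain ⟨f, hf⟩ := SmoothPartitionOfUnity.exists_isSubordinate_chartAt_source (𝓡 n) M
  have hfin := f.locallyFinite.finite_nonempty_inter_compact hGc.isCompact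
  refine ⟨hfin.toFinset, fun i x ↦ f i x * G x, fun i ↦ (f i).contMDiff.mul hG,
    fun i ↦ hGc.mul_left, fun i ↦ tsupport_mul_subset_left.trans (hf i), fun x ↦ ?_⟩
  by_cases hx : x ∈ tsupport G
  · have h1 := f.sum_eq_one (mem_univ x)
    rw [finsum_eq_sum_of_support_subset (s := hfin.toFinset)] at h1
    · rw [← Finset.sum_mul, h1, one_mul]
    · intro i hi
      simp only [Finite.coe_toFinset]
      exact ⟨x, hi, hx⟩
  · simp [image_eq_zero_of_notMem_tsupport hx]

end DivergenceTheorem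

/-! ### The global divergence theorem and integration by parts. -/

section

variable {n : ℕ} {M : Type*} [TopologicalSpace M] [ChartedSpace (EuclideanSpace ℝ (Fin (n + 1))) M]
  [IsManifold (𝓡 (n + 1)) ∞ M] [T2Space M] [MeasurableSpace M] [BorelSpace M] [Nonempty M]
  [SecondCountableTopology M]

local notation "𝔼" => EuclideanSpace ℝ (Fin (n + 1))

theorem divergence_eq_chartDivergence_of_mem_source (μ : VolumeForm (n + 1) M)
    {X : ∀ x : M, TangentSpace (𝓡 (n + 1)) x} (hX : SmoothField X) {x₀ x : M}
    (hx : x ∈ (chartAt 𝔼 x₀).source) :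
    divergence μ X x = chartDivergence μ X x₀ (chartAt 𝔼 x₀ x) :=
  (divergence_eq_chartDivergence μ hX x).trans
    (chartDivergence_eq μ hX x x₀ (mem_chart_source 𝔼 x) hx)

/-- The definition uses a different chart at each point, so continuity is not visible from it; chart
independence allows one fixed chart near `x₀`. -/
theorem continuous_divergence (μ : VolumeForm (n + 1) M)
    {X : ∀ x : M, TangentSpace (𝓡 (n + 1)) x} (hX : SmoothField X) :
    Continuous (divergence μ X) := by
  rw [continuous_iff_continuousAt]
  intro x₀
  have hs := (chartAt 𝔼 x₀).open_source.mem_nhds (mem_chart_source 𝔼 x₀)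
  refine ((continuousOn_chartDivergence_comp_chart μ hX x₀).continuousAt hs).congr ?_
  filter_upwards [hs] with x hx
  exact (divergence_eq_chartDivergence_of_mem_source μ hX hx).symm

/-- The divergence theorem, for the product of a compactly supported function and a vector
field. -/
theorem integral_differential_add_mul_divergence (μ : VolumeForm (n + 1) M)
    {X : ∀ x : M, TangentSpace (𝓡 (n + 1)) x} (hX : SmoothField X) {G : M → ℝ}
    (hG : ContMDiff (𝓡 (n + 1)) 𝓘(ℝ, ℝ) ∞ G) (hGc : HasCompactSupport G) :
    ∫ x, (differential G x (X x) + G x * divergence μ X x) ∂(volumeMeasure μ) = 0 := by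
  have := isLocallyFiniteMeasure_volumeMeasure μ
  obtain ⟨s, g, hg, hgc, hgs, hsum⟩ := exists_finset_sum_partition hG hGc
  have h1 : ∀ x, differential G x (X x) + G x * divergence μ X x =
      ∑ i ∈ s, (differential (g i) x (X x) + g i x * divergence μ X x) := by
    intro x
    have hd' : differential G x (X x) = ∑ i ∈ s, differential (g i) x (X x) := by
      rw [funext hsum, differential_sum s fun i _ ↦ (hg i).mdifferentiableAt (by simp)]
    rw [hd', hsum x, Finset.sum_mul, Finset.sum_add_distrib]
  simp only [h1]
  rw [integral_finsetSum]
  · refine Finset.sum_eq_zero fun i _ ↦ ?_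
    rw [← integral_differential_add_mul_chartDivergence μ hX i (hg i) (hgc i) (hgs i)]
    refine integral_congr_ae (Filter.Eventually.of_forall fun x ↦ ?_)
    simp only
    -- Off the chart domain the two divergences may differ, but there `g i` vanishes.
    by_cases hx : x ∈ (chartAt 𝔼 i).source
    · rw [divergence_eq_chartDivergence_of_mem_source μ hX hx]
    · rw [image_eq_zero_of_notMem_tsupport fun h ↦ hx (hgs i h)]
      simp
  · intro i _
    exact ((continuous_differential_apply hX (hg i)).integrable_of_hasCompactSupport
      (hasCompactSupport_differential_apply X (hgc i))).add
      (((hg i).continuous.mul (continuous_divergence μ hX)).integrable_of_hasCompactSupport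
        (hgc i).mul_right)

theorem integral_differential_eq_neg (μ : VolumeForm (n + 1) M)
    {X : ∀ x : M, TangentSpace (𝓡 (n + 1)) x} (hX : SmoothField X) {G : M → ℝ}
    (hG : ContMDiff (𝓡 (n + 1)) 𝓘(ℝ, ℝ) ∞ G) (hGc : HasCompactSupport G) :
    ∫ x, differential G x (X x) ∂(volumeMeasure μ) =
      -∫ x, G x * divergence μ X x ∂(volumeMeasure μ) := by
  have := isLocallyFiniteMeasure_volumeMeasure μ
  rw [eq_neg_iff_add_eq_zero, ← integral_add, integral_differential_add_mul_divergence μ hX hG hGc]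
  · exact (continuous_differential_apply hX hG).integrable_of_hasCompactSupport
      (hasCompactSupport_differential_apply X hGc)
  · exact (hG.continuous.mul (continuous_divergence μ hX)).integrable_of_hasCompactSupport
      hGc.mul_right

end

/-! ### Smoothness of the left and right gradients. -/

section Gradient

variable {n : ℕ} {M : Type*} [TopologicalSpace M] [ChartedSpace (EuclideanSpace ℝ (Fin n)) M]
  [IsManifold (𝓡 n) ∞ M]

local notation "𝔼" => EuclideanSpace ℝ (Fin n)

/-- The solution of a smooth family of non-degenerate linear systems is smooth. -/
theorem contDiffOn_of_bilinear_eq {V : Type*} [NormedAddCommGroup V] [NormedSpace ℝ V]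
    [FiniteDimensional ℝ V] {O : Set V} {A : V → V →L[ℝ] V →L[ℝ] ℝ}
    (hA : ∀ v w, ContDiffOn ℝ ∞ (fun y ↦ A y v w) O)
    (hinj : ∀ y ∈ O, ∀ v, (∀ w, A y v w = 0) → v = 0) {φ : V → V →L[ℝ] ℝ}
    (hφ : ContDiffOn ℝ ∞ φ O) {u : V → V} (hu : ∀ y ∈ O, ∀ w, A y (u y) w = φ y w) :
    ContDiffOn ℝ ∞ u O := by
  have : CompleteSpace V := FiniteDimensional.complete ℝ V
  -- In finite dimension, smoothness of all scalar entries gives smoothness of the operator-valued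
  -- map.
  have hA' : ContDiffOn ℝ ∞ A O :=
    contDiffOn_clm_apply.2 fun v ↦ contDiffOn_clm_apply.2 fun w ↦ hA v w
  have hrank : Module.finrank ℝ V = Module.finrank ℝ (V →L[ℝ] ℝ) := by
    rw [← (LinearMap.toContinuousLinearMap (𝕜 := ℝ) (E := V) (F' := ℝ)).finrank_eq]
    exact (Subspace.dual_finrank_eq (K := ℝ) (V := V)).symm
  have hequiv : ∀ y ∈ O, ∃ L : V ≃L[ℝ] (V →L[ℝ] ℝ), (L : V →L[ℝ] V →L[ℝ] ℝ) = A y := by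
    intro y hy
    have hi : Function.Injective (A y : V →ₗ[ℝ] V →L[ℝ] ℝ) := by
      rw [injective_iff_map_eq_zero]
      intro v hv
      exact hinj y hy v fun w ↦ DFunLike.congr_fun hv w
    refine ⟨(LinearMap.linearEquivOfInjective _ hi hrank).toContinuousLinearEquiv, ?_⟩
    ext v w
    rfl
  -- The solution is the inverse operator applied to the right-hand side, and inversion is smooth at
  -- invertible operators.
  have hu' : ∀ y ∈ O, u y = (A y).inverse (φ y) := by
    intro y hy
    obtain ⟨L, hL⟩ := hequiv y hy
    have h : A y (u y) = φ y := ContinuousLinearMap.ext (hu y hy)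
    rw [← h, ← hL, ContinuousLinearMap.inverse_equiv]
    simp
  refine ContDiffOn.congr (ContDiffOn.clm_apply ?_ hφ) hu'
  intro y hy
  obtain ⟨L, hL⟩ := hequiv y hy
  have h1 : ContDiffAt ℝ ∞ ContinuousLinearMap.inverse (A y) := hL ▸ contDiffAt_map_inverse L
  exact h1.comp_contDiffWithinAt y (hA' y hy)

/-- A bilinear form on the tangent spaces, read in the preferred chart at `x₀`. -/
def bilinInChart (B : ∀ x : M, TangentSpace (𝓡 n) x →L[ℝ] TangentSpace (𝓡 n) x →L[ℝ] ℝ) (x₀ : M)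
    (y : EuclideanSpace ℝ (Fin n)) :
    EuclideanSpace ℝ (Fin n) →L[ℝ] EuclideanSpace ℝ (Fin n) →L[ℝ] ℝ :=
  let B' : EuclideanSpace ℝ (Fin n) →L[ℝ] EuclideanSpace ℝ (Fin n) →L[ℝ] ℝ :=
    B ((chartAt (EuclideanSpace ℝ (Fin n)) x₀).symm y)
  let D : EuclideanSpace ℝ (Fin n) →L[ℝ] EuclideanSpace ℝ (Fin n) := chartSymmDeriv x₀ y
  B'.bilinearComp D D

theorem bilinInChart_apply
    (B : ∀ x : M, TangentSpace (𝓡 n) x →L[ℝ] TangentSpace (𝓡 n) x →L[ℝ] ℝ) (x₀ : M) (y v w : 𝔼) :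
    bilinInChart B x₀ y v w = B ((chartAt 𝔼 x₀).symm y) (chartSymmDeriv x₀ y v)
      (chartSymmDeriv x₀ y w) :=
  rfl

theorem chartSymmDeriv_chartDeriv {x₀ : M} {y : 𝔼} (hy : y ∈ (chartAt 𝔼 x₀).target)
    (v : TangentSpace (𝓡 n) ((chartAt 𝔼 x₀).symm y)) :
    chartSymmDeriv x₀ y (chartDeriv x₀ ((chartAt 𝔼 x₀).symm y) v) = v :=
  chartDeriv_injective ((chartAt 𝔼 x₀).map_target hy) (chartDeriv_chartSymmDeriv hy _)

/-- In the trivialization of the tangent bundle at `x₀`, the coordinate field of `v` is the constant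
`v`. -/
theorem contMDiffOn_chartSymmDeriv (x₀ : M) (v : 𝔼) :
    ContMDiffOn (𝓡 n) ((𝓡 n).prod 𝓘(ℝ, 𝔼)) ∞
      (fun y ↦ Bundle.TotalSpace.mk' 𝔼 (E := fun x : M ↦ TangentSpace (𝓡 n) x)
        ((chartAt 𝔼 x₀).symm y) (chartSymmDeriv x₀ y v)) (chartAt 𝔼 x₀).target := by
  set t := trivializationAt 𝔼 (TangentSpace (𝓡 n) : M → Type _) x₀
  have hmaps : MapsTo (fun y ↦ Bundle.TotalSpace.mk' 𝔼 (E := fun x : M ↦ TangentSpace (𝓡 n) x)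
        ((chartAt 𝔼 x₀).symm y) (chartSymmDeriv x₀ y v)) (chartAt 𝔼 x₀).target t.source := by
    intro y hy
    rw [t.mem_source]
    exact (chartAt 𝔼 x₀).map_target hy
  rw [t.contMDiffOn_iff hmaps]
  refine ⟨contMDiffOn_chart_symm, (contMDiffOn_const (c := v)).congr fun y hy ↦ ?_⟩
  have hx := (chartAt 𝔼 x₀).map_target hy
  have h1 := TangentBundle.continuousLinearMapAt_trivializationAt (I := 𝓡 n) hx
  have h2 := DFunLike.congr_fun h1 (chartSymmDeriv x₀ y v)
  rw [Bundle.Trivialization.continuousLinearMapAt_apply,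
    Bundle.Trivialization.linearMapAt_apply, if_pos (show _ ∈ t.baseSet from hx)] at h2
  refine h2.trans ?_
  exact chartDeriv_chartSymmDeriv hy v

/-- The entries of the matrix of `b` come from applying a smooth bundle section to two smooth
coordinate fields. This converts the bundle notion of smoothness into the coordinate one. -/
theorem GeometricStructure.contDiffOn_bilinInChart (b : GeometricStructure n M) (x₀ : M)
    (v w : 𝔼) :
    ContDiffOn ℝ ∞ (fun y ↦ bilinInChart b.toFun x₀ y v w) (chartAt 𝔼 x₀).target := by
  have h : ContMDiffOn (𝓡 n) ((𝓡 n).prod 𝓘(ℝ, ℝ)) ∞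
      (fun y ↦ Bundle.TotalSpace.mk' ℝ (E := Bundle.Trivial M ℝ) ((chartAt 𝔼 x₀).symm y)
        (b.toFun ((chartAt 𝔼 x₀).symm y) (chartSymmDeriv x₀ y v) (chartSymmDeriv x₀ y w)))
      (chartAt 𝔼 x₀).target := by
    apply ContMDiffOn.clm_bundle_apply₂ (F₁ := 𝔼) (F₂ := 𝔼)
    · exact b.smooth.comp_contMDiffOn contMDiffOn_chart_symm
    · exact contMDiffOn_chartSymmDeriv x₀ v
    · exact contMDiffOn_chartSymmDeriv x₀ w
  intro y hy
  have h2 := h y hy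
  rw [Bundle.contMDiffWithinAt_totalSpace] at h2
  exact h2.2.contDiffWithinAt

theorem differential_chartSymmDeriv {F : M → ℝ} (hF : ContMDiff (𝓡 n) 𝓘(ℝ, ℝ) ∞ F) {x₀ : M}
    {y : 𝔼} (hy : y ∈ (chartAt 𝔼 x₀).target) (w : 𝔼) :
    differential F ((chartAt 𝔼 x₀).symm y) (chartSymmDeriv x₀ y w) =
      fderiv ℝ (F ∘ (chartAt 𝔼 x₀).symm) y w := by
  rw [differential_eq_fderiv ((chartAt 𝔼 x₀).map_target hy) (hF.mdifferentiableAt (by simp)),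
    chartDeriv_chartSymmDeriv hy, (chartAt 𝔼 x₀).right_inv hy]

theorem GeometricStructure.apply_leftGrad (b : GeometricStructure n M) (F : M → ℝ) (x : M)
    (w : TangentSpace (𝓡 n) x) : b.toFun x (b.leftGrad F x) w = differential F x w :=
  (b.existsUnique_left F x).choose_spec.1 w

theorem GeometricStructure.apply_rightGrad (b : GeometricStructure n M) (F : M → ℝ) (x : M)
    (w : TangentSpace (𝓡 n) x) : b.toFun x w (b.rightGrad F x) = differential F x w :=
  (b.existsUnique_right F x).choose_spec.1 w

theorem fieldInChart_of_mem_target (X : ∀ x : M, TangentSpace (𝓡 n) x) (x₀ : M) (y : 𝔼) :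
    fieldInChart X x₀ y =
      chartDeriv x₀ ((chartAt 𝔼 x₀).symm y) (X ((chartAt 𝔼 x₀).symm y)) :=
  rfl

theorem chartSymmDeriv_surjective {x₀ : M} {y : 𝔼} (hy : y ∈ (chartAt 𝔼 x₀).target) :
    Function.Surjective (chartSymmDeriv (n := n) x₀ y) :=
  fun v ↦ ⟨_, chartSymmDeriv_chartDeriv hy v⟩

theorem chartSymmDeriv_injective {x₀ : M} {y : 𝔼} (hy : y ∈ (chartAt 𝔼 x₀).target) :
    Function.Injective (chartSymmDeriv (n := n) x₀ y) :=
  Function.LeftInverse.injective (chartDeriv_chartSymmDeriv hy)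

/-- In a chart the gradient solves the linear system whose matrix is that of `b` and whose
right-hand side is the derivative of `F`. -/
theorem GeometricStructure.smoothField_leftGrad (b : GeometricStructure n M) {F : M → ℝ}
    (hF : ContMDiff (𝓡 n) 𝓘(ℝ, ℝ) ∞ F) : SmoothField (b.leftGrad F) := by
  intro x₀
  refine contDiffOn_of_bilinear_eq (A := bilinInChart b.toFun x₀)
    (φ := fderiv ℝ (F ∘ (chartAt 𝔼 x₀).symm)) (b.contDiffOn_bilinInChart x₀) ?_
    ((contDiffOn_comp_chart_symm hF x₀).fderiv_of_isOpen (chartAt 𝔼 x₀).open_target (by simp)) ?_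
  · intro y hy v hv
    apply chartSymmDeriv_injective hy
    rw [map_zero]
    refine b.nondegenerate_left _ _ fun w ↦ ?_
    obtain ⟨w, rfl⟩ := chartSymmDeriv_surjective hy w
    exact hv w
  · intro y hy w
    rw [bilinInChart_apply, fieldInChart_of_mem_target, chartSymmDeriv_chartDeriv hy,
      b.apply_leftGrad, differential_chartSymmDeriv hF hy]

theorem GeometricStructure.smoothField_rightGrad (b : GeometricStructure n M) {F : M → ℝ}
    (hF : ContMDiff (𝓡 n) 𝓘(ℝ, ℝ) ∞ F) : SmoothField (b.rightGrad F) := by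
  intro x₀
  refine contDiffOn_of_bilinear_eq (A := fun y ↦ (bilinInChart b.toFun x₀ y).flip)
    (φ := fderiv ℝ (F ∘ (chartAt 𝔼 x₀).symm)) (fun v w ↦ b.contDiffOn_bilinInChart x₀ w v) ?_
    ((contDiffOn_comp_chart_symm hF x₀).fderiv_of_isOpen (chartAt 𝔼 x₀).open_target (by simp)) ?_
  · intro y hy v hv
    apply chartSymmDeriv_injective hy
    rw [map_zero]
    refine b.nondegenerate_right _ _ fun w ↦ ?_
    obtain ⟨w, rfl⟩ := chartSymmDeriv_surjective hy w
    exact hv w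
  · intro y hy w
    rw [ContinuousLinearMap.flip_apply, bilinInChart_apply, fieldInChart_of_mem_target,
      chartSymmDeriv_chartDeriv hy, b.apply_rightGrad, differential_chartSymmDeriv hF hy]

end Gradient

/-! ### Expansion of the bracket along a variation, and the fundamental lemma. -/

section Energy

variable {n : ℕ} {M : Type*} [TopologicalSpace M] [ChartedSpace (EuclideanSpace ℝ (Fin n)) M]
  [IsManifold (𝓡 n) ∞ M]

theorem GeometricStructure.leftGrad_add_const_mul (b : GeometricStructure n M) {F G : M → ℝ}
    {x : M} (hF : MDifferentiableAt (𝓡 n) 𝓘(ℝ, ℝ) F x)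
    (hG : MDifferentiableAt (𝓡 n) 𝓘(ℝ, ℝ) G x) (t : ℝ) :
    b.leftGrad (fun z ↦ F z + t * G z) x = b.leftGrad F x + t • b.leftGrad G x := by
  refine (b.existsUnique_left (fun z ↦ F z + t * G z) x).unique
    (b.apply_leftGrad _ x) fun w ↦ ?_
  have htG : MDifferentiableAt (𝓡 n) 𝓘(ℝ, ℝ) (fun z ↦ t * G z) x := hG.const_smul t
  rw [differential_add hF htG, differential_const_mul t hG, map_add, map_smul,
    add_apply, smul_apply, b.apply_leftGrad, b.apply_leftGrad, smul_eq_mul]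

theorem GeometricStructure.bracket_eq_differential (b : GeometricStructure n M) (F G : M → ℝ)
    (x : M) : b.bracket F G x = differential F x (b.leftGrad G x) :=
  b.apply_leftGrad F x _

/-- The chain is `b(∇ᴸF, ∇ᴸG) = dF(∇ᴸG) = b(∇ᴸG, ∇ᴿF) = dG(∇ᴿF)`. It moves the derivative onto the
second argument, which is how the right gradient enters the first variation. -/
theorem GeometricStructure.bracket_eq_differential_rightGrad (b : GeometricStructure n M)
    (F G : M → ℝ) (x : M) : b.bracket F G x = differential G x (b.rightGrad F x) := by
  rw [b.bracket_eq_differential, ← b.apply_rightGrad, b.apply_leftGrad]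

/-- The cross terms are `{G, F}` and `{F, G}`, both written as `dG` of a gradient of `F` so that
they are ready for integration by parts. -/
theorem GeometricStructure.bracket_add_const_mul (b : GeometricStructure n M) {F G : M → ℝ}
    {x : M} (hF : MDifferentiableAt (𝓡 n) 𝓘(ℝ, ℝ) F x)
    (hG : MDifferentiableAt (𝓡 n) 𝓘(ℝ, ℝ) G x) (t : ℝ) :
    b.bracket (fun z ↦ F z + t * G z) (fun z ↦ F z + t * G z) x =
      b.bracket F F x +
        t * (differential G x (b.leftGrad F x) + differential G x (b.rightGrad F x)) +
        t ^ 2 * b.bracket G G x := by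
  rw [← b.bracket_eq_differential, ← b.bracket_eq_differential_rightGrad]
  simp only [bracket]
  rw [b.leftGrad_add_const_mul hF hG]
  simp only [map_add, map_smul, add_apply, smul_apply,
    smul_eq_mul]
  ring

theorem GeometricStructure.continuous_bracket_self (b : GeometricStructure n M) {F : M → ℝ}
    (hF : ContMDiff (𝓡 n) 𝓘(ℝ, ℝ) ∞ F) : Continuous (b.bracket F F) := by
  rw [funext (b.bracket_eq_differential F F)]
  exact continuous_differential_apply (b.smoothField_leftGrad hF) hF

theorem GeometricStructure.hasCompactSupport_bracket_self [T2Space M]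
    (b : GeometricStructure n M) {F : M → ℝ} (hF : HasCompactSupport F) :
    HasCompactSupport (b.bracket F F) := by
  rw [funext (b.bracket_eq_differential F F)]
  exact hasCompactSupport_differential_apply _ hF

variable [T2Space M] [MeasurableSpace M] [BorelSpace M] [Nonempty M] [SecondCountableTopology M]

/-- A continuous function on a manifold vanishes if it is orthogonal to all test functions. -/
theorem eq_zero_of_integral_mul_eq_zero (μ : VolumeForm n M) {u : M → ℝ} (hu : Continuous u)
    (h : ∀ G : M → ℝ, ContMDiff (𝓡 n) 𝓘(ℝ, ℝ) ∞ G → HasCompactSupport G →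
      ∫ x, G x * u x ∂(volumeMeasure μ) = 0) (x : M) : u x = 0 := by
  have := isLocallyFiniteMeasure_volumeMeasure μ
  have := isOpenPosMeasure_volumeMeasure μ
  have : LocallyCompactSpace M :=
    ChartedSpace.locallyCompactSpace (EuclideanSpace ℝ (Fin n)) M
  have hae : u =ᵐ[volumeMeasure μ] fun _ ↦ (0 : ℝ) :=
    ae_eq_zero_of_integral_contMDiff_smul_eq_zero (𝓡 n) hu.locallyIntegrable h
  exact congr_fun (Continuous.ae_eq_iff_eq (volumeMeasure μ) hu continuous_const |>.1 hae) x

end Energy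

/-! ### First variation and the Euler–Lagrange equation. -/

section EulerLagrange

variable {n : ℕ} {M : Type*} [TopologicalSpace M] [ChartedSpace (EuclideanSpace ℝ (Fin (n + 1))) M]
  [IsManifold (𝓡 (n + 1)) ∞ M] [T2Space M] [MeasurableSpace M] [BorelSpace M] [Nonempty M]
  [SecondCountableTopology M]

/-- The first variation of the Dirichlet energy. -/
theorem hasDerivAt_dirichletEnergyOn (b : GeometricStructure (n + 1) M)
    (μ : VolumeForm (n + 1) M) {F G : M → ℝ} (hF : ContMDiff (𝓡 (n + 1)) 𝓘(ℝ, ℝ) ∞ F)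
    (hG : ContMDiff (𝓡 (n + 1)) 𝓘(ℝ, ℝ) ∞ G) (hGc : HasCompactSupport G) {K : Set M}
    (hGK : tsupport G ⊆ K) (hint : IntegrableOn (b.bracket F F) K (volumeMeasure μ)) :
    HasDerivAt (fun t : ℝ ↦ dirichletEnergyOn b μ K (fun x ↦ F x + t * G x))
      (-∫ x, G x * ((1 / 2) * (leftLaplacian b μ F x + rightLaplacian b μ F x))
        ∂(volumeMeasure μ)) 0 := by
  have := isLocallyFiniteMeasure_volumeMeasure μ
  have hL := b.smoothField_leftGrad hF
  have hR := b.smoothField_rightGrad hF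
  have iL : Integrable (fun x ↦ differential G x (b.leftGrad F x)) (volumeMeasure μ) :=
    (continuous_differential_apply hL hG).integrable_of_hasCompactSupport
      (hasCompactSupport_differential_apply _ hGc)
  have iR : Integrable (fun x ↦ differential G x (b.rightGrad F x)) (volumeMeasure μ) :=
    (continuous_differential_apply hR hG).integrable_of_hasCompactSupport
      (hasCompactSupport_differential_apply _ hGc)
  have iG : Integrable (b.bracket G G) (volumeMeasure μ) :=
    (b.continuous_bracket_self hG).integrable_of_hasCompactSupport
      (b.hasCompactSupport_bracket_self hGc)
  have jL : Integrable (fun x ↦ G x * divergence μ (b.leftGrad F) x) (volumeMeasure μ) :=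
    (hG.continuous.mul (continuous_divergence μ hL)).integrable_of_hasCompactSupport hGc.mul_right
  have jR : Integrable (fun x ↦ G x * divergence μ (b.rightGrad F) x) (volumeMeasure μ) :=
    (hG.continuous.mul (continuous_divergence μ hR)).integrable_of_hasCompactSupport hGc.mul_right
  set c : M → ℝ := fun x ↦ differential G x (b.leftGrad F x) + differential G x (b.rightGrad F x)
    with hc
  -- The cross term vanishes off the support of `G`, so no boundary term arises from `K`.
  have hcK : ∫ x in K, c x ∂(volumeMeasure μ) = ∫ x, c x ∂(volumeMeasure μ) :=
    setIntegral_eq_integral_of_forall_compl_eq_zero fun x hx ↦ by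
      simp [hc, differential_eq_zero_of_notMem_tsupport fun h ↦ hx (hGK h)]
  have hcint : (1 / 2) * ∫ x in K, c x ∂(volumeMeasure μ) =
      -∫ x, G x * ((1 / 2) * (leftLaplacian b μ F x + rightLaplacian b μ F x))
        ∂(volumeMeasure μ) := by
    have h1 : ∀ x, G x * ((1 / 2) * (leftLaplacian b μ F x + rightLaplacian b μ F x)) =
        (1 / 2) * (G x * divergence μ (b.leftGrad F) x + G x * divergence μ (b.rightGrad F) x) :=
      fun x ↦ by simp only [leftLaplacian, rightLaplacian]; ring
    simp only [h1]
    rw [hcK, integral_add iL iR, integral_differential_eq_neg μ hL hG hGc,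
      integral_differential_eq_neg μ hR hG hGc, integral_const_mul, integral_add jL jR]
    ring
  -- The energy is a polynomial in `t`, so its derivative at `0` is the linear coefficient and no
  -- differentiation under the integral is needed.
  have hE : ∀ t : ℝ, dirichletEnergyOn b μ K (fun x ↦ F x + t * G x) =
      (1 / 2) * (∫ x in K, b.bracket F F x ∂(volumeMeasure μ) +
        t * ∫ x in K, c x ∂(volumeMeasure μ) +
        t ^ 2 * ∫ x in K, b.bracket G G x ∂(volumeMeasure μ)) := by
    intro t
    have hx : ∀ x, b.bracket (fun z ↦ F z + t * G z) (fun z ↦ F z + t * G z) x =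
        b.bracket F F x + t * c x + t ^ 2 * b.bracket G G x := fun x ↦
      b.bracket_add_const_mul (hF.mdifferentiableAt (by simp)) (hG.mdifferentiableAt (by simp)) t
    have ic : IntegrableOn (fun x ↦ t * c x) K (volumeMeasure μ) :=
      ((iL.add iR).const_mul t).integrableOn
    simp only [dirichletEnergyOn, hx]
    have i1 : IntegrableOn (fun x ↦ b.bracket F F x + t * c x) K (volumeMeasure μ) := hint.add ic
    rw [integral_add i1 (iG.integrableOn.const_mul _), integral_add hint ic,
      integral_const_mul, integral_const_mul]
  simp only [hE]
  rw [← hcint]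
  have h1 := ((hasDerivAt_id (0 : ℝ)).mul_const (∫ x in K, c x ∂(volumeMeasure μ)))
  have h2 := (((hasDerivAt_id (0 : ℝ)).pow 2).mul_const
    (∫ x in K, b.bracket G G x ∂(volumeMeasure μ)))
  convert! ((h1.const_add (∫ x in K, b.bracket F F x ∂(volumeMeasure μ))).add h2).const_mul
    (1 / 2 : ℝ) using 1
  simp

theorem dirichletEnergy_eq_dirichletEnergyOn_univ (b : GeometricStructure (n + 1) M)
    (μ : VolumeForm (n + 1) M) (F : M → ℝ) :
    dirichletEnergy b μ F = dirichletEnergyOn b μ univ F := by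
  rw [dirichletEnergy, dirichletEnergyOn, Measure.restrict_univ]

theorem continuous_half_leftLaplacian_add_rightLaplacian (b : GeometricStructure (n + 1) M)
    (μ : VolumeForm (n + 1) M) {F : M → ℝ} (hF : ContMDiff (𝓡 (n + 1)) 𝓘(ℝ, ℝ) ∞ F) :
    Continuous fun x ↦ (1 / 2) * (leftLaplacian b μ F x + rightLaplacian b μ F x) :=
  continuous_const.mul ((continuous_divergence μ (b.smoothField_leftGrad hF)).add
    (continuous_divergence μ (b.smoothField_rightGrad hF)))

theorem isCritical_iff (b : GeometricStructure (n + 1) M)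
    (μ : VolumeForm (n + 1) M) {F : M → ℝ} (hF : ContMDiff (𝓡 (n + 1)) 𝓘(ℝ, ℝ) ∞ F)
    (hfin : HasFiniteEnergy b μ F) :
    IsCritical b μ F ↔
      ∀ x, (1 / 2) * (leftLaplacian b μ F x + rightLaplacian b μ F x) = 0 := by
  have hderiv := fun (G : M → ℝ) (hG : ContMDiff (𝓡 (n + 1)) 𝓘(ℝ, ℝ) ∞ G)
    (hGc : HasCompactSupport G) ↦ hasDerivAt_dirichletEnergyOn b μ hF hG hGc (subset_univ _)
      (Integrable.integrableOn hfin)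
  simp only [← dirichletEnergy_eq_dirichletEnergyOn_univ] at hderiv
  constructor
  · intro h
    -- The derivative at `0` is unique, so the first variation must equal the assumed value `0` for
    -- every test function.
    refine eq_zero_of_integral_mul_eq_zero μ
      (continuous_half_leftLaplacian_add_rightLaplacian b μ hF) fun G hG hGc ↦ ?_
    exact neg_eq_zero.1 ((hderiv G hG hGc).unique (h G hG hGc))
  · intro h G hG hGc
    simpa only [h, mul_zero, integral_zero, neg_zero] using hderiv G hG hGc

theorem isLocallyCritical_iff (b : GeometricStructure (n + 1) M)
    (μ : VolumeForm (n + 1) M) {F : M → ℝ} (hF : ContMDiff (𝓡 (n + 1)) 𝓘(ℝ, ℝ) ∞ F) :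
    IsLocallyCritical b μ F ↔
      ∀ x, (1 / 2) * (leftLaplacian b μ F x + rightLaplacian b μ F x) = 0 := by
  have := isLocallyFiniteMeasure_volumeMeasure μ
  have hderiv := fun (K : Set M) (hK : IsCompact K) (G : M → ℝ)
    (hG : ContMDiff (𝓡 (n + 1)) 𝓘(ℝ, ℝ) ∞ G) (hGK : tsupport G ⊆ K) ↦
      hasDerivAt_dirichletEnergyOn b μ hF hG (hK.of_isClosed_subset (isClosed_tsupport G) hGK) hGK
      ((b.continuous_bracket_self hF).continuousOn.integrableOn_compact hK)
  constructor
  · intro h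
    refine eq_zero_of_integral_mul_eq_zero μ
      (continuous_half_leftLaplacian_add_rightLaplacian b μ hF) fun G hG hGc ↦ ?_
    -- The compact set taken for a given `G` is its own support.
    exact neg_eq_zero.1 ((hderiv _ hGc G hG subset_rfl).unique (h _ G hGc hG subset_rfl))
  · intro h K G hK hG hGK
    simpa only [h, mul_zero, integral_zero, neg_zero] using hderiv K hK G hG hGK

end EulerLagrange

end

end GeomDirichlet

theorem theorem5p8 {n : ℕ} {M : Type*} [TopologicalSpace M] [Nonempty M] [T2Space M]
    [SecondCountableTopology M] [ChartedSpace (EuclideanSpace ℝ (Fin (n + 1))) M]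
    [IsManifold (𝓡 (n + 1)) ∞ M] [MeasurableSpace M] [BorelSpace M]
    (μ : GeomDirichlet.VolumeForm (n + 1) M) (b : GeomDirichlet.GeometricStructure (n + 1) M)
    (hb : ¬ b.IsSkew) (F : M → ℝ) (hF : ContMDiff (𝓡 (n + 1)) 𝓘(ℝ, ℝ) ∞ F) :
    (GeomDirichlet.HasFiniteEnergy b μ F →
      (GeomDirichlet.IsCritical b μ F ↔
        ∀ x, (1 / 2) * (GeomDirichlet.leftLaplacian b μ F x +
          GeomDirichlet.rightLaplacian b μ F x) = 0)) ∧
    (GeomDirichlet.IsLocallyCritical b μ F ↔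
      ∀ x, (1 / 2) * (GeomDirichlet.leftLaplacian b μ F x +
        GeomDirichlet.rightLaplacian b μ F x) = 0) :=
  ⟨fun h ↦ GeomDirichlet.isCritical_iff b μ hF h, GeomDirichlet.isLocallyCritical_iff b μ hF⟩
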